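/- Let $n\ge 1$ and $m\ge 0$ be integers and let $n<q<p<\infty$. On $\mathbb{R}^n$ let $\|x\|=\max_i|x_i|$; a cube is a closed (non-degenerate) cube with sides parallel to the coordinate axes. For a non-negative $h\in L_p(\mathbb{R}^n)$ put $$\delta_q(x,y:h)=\|x-y\|\,\sup_{Q\ni x,y}\Big(\frac1{|Q|}\int_Q h^q(u)\,du\Big)^{1/q}\ \ (x\neq y),\qquad \delta_q(x,x:h)=0,$$ the supremum being over all cubes $Q$ containing $x$ and $y$, and let $$d_q(x,y:h)=\inf\sum_{i=0}^{k-1}\delta_q(z_i,z_{i+1}:h),$$ the infimum being over all finite sequences $z_0=x,z_1,\dots,z_k=y$ in $\mathbb{R}^n$. Let $\mathcal{D}_{p,q}=\{d_q(h): h\in L_p(\mathbb{R}^n),\ h\ge 0\}$. For $d\in\mathcal{D}_{p,q}$ let $C^{m,(d)}(\mathbb{R}^n)$ be the space of all real-valued $C^m$ functions $F$ on $\mathbb{R}^n$ whose partial derivatives of order $m$ are Lipschitz with respect to $d$, with the seminorm $$\|F\|_{C^{m,(d)}}=\sum_{|\alpha|=m}\ \sup_{x\ne y}\frac{|D^\alpha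 F(x)-D^\alpha F(y)|}{d(x,y)}.$$ (Here and below $0/0=0$ and $a/0=\infty$ for $a>0$; this matters only if $h=0$ almost everywhere, when $d\equiv 0$.) A Whitney $m$-field on a set $E\subset\mathbb{R}^n$ is a family $\mathbf{P}=\{P_x:x\in E\}$ of real polynomials on $\mathbb{R}^n$ of degree at most $m$. A function $F\in C^m(\mathbb{R}^n)$ agrees with $\mathbf{P}$ on $E$ if for every $x\in E$ its Taylor polynomial of degree $m$ at $x$, $T^m_x[F](y)=\sum_{|\alpha|\le m}\frac1{\alpha!}D^\alpha F(x)(y-x)^\alpha$, equals $P_x$. Put $$\mathcal{L}_{m,d}(\mathbf{P})=\sup_{x,y\in E,\,x\ne y}\ \sum_{|\alpha|\le m}\frac{|D^\alpha P_x(x)-D^\alpha P_y(x)|}{\|x-y\|^{m-|\alpha|}\,d(x,y)}$$ (a supremum over the empty set is $0$). Theorem. There is a constant $C\ge 1$ depending only on $n,m,p,q$ such that for every $d\in\mathcal{D}_{p,q}$, every closed set $E\subset\mathbb{R}^n$ and every Whitney $m$-field $\mathbf{P}$ on $E$ the following hold. (i) There is a function $F\in C^{m,(d)}(\mathbb{R}^n)$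 that agrees with $\mathbf{P}$ on $E$ if and only if $\mathcal{L}_{m,d}(\mathbf{P})<\infty$. (ii) With the convention $\inf\emptyset=\infty$, $$\frac1C\,\mathcal{L}_{m,d}(\mathbf{P})\le\inf\{\|F\|_{C^{m,(d)}}: F\in C^{m,(d)}(\mathbb{R}^n),\ F\text{ agrees with }\mathbf{P}\text{ on }E\}\le C\,\mathcal{L}_{m,d}(\mathbf{P}).$$ -/

import Mathlib

open MeasureTheory
open scoped ENNReal NNReal

noncomputable section

namespace WhitneyJet

/-- `ℝⁿ`. The norm of `Fin n → ℝ` is the uniform norm `‖x‖ = max |xᵢ|`, and `volume` is Lebesgue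
measure, so closed cubes with sides parallel to the axes are the sets `Metric.closedBall c r`,
`r > 0`. -/
abbrev RN (n : ℕ) : Type := Fin n → ℝ

/-! ### The distances `d_q(h)` -/

/-- `δ_q(x,y : h) = ‖x - y‖ * sup_{Q ∋ x, y} (|Q|⁻¹ ∫_Q h^q)^{1/q}`, the supremum being over all
closed cubes `Q` containing `x` and `y`. In `ℝ≥0∞` one has `0 * ∞ = 0`, so `δ_q(x,x : h) = 0`. -/
def preDist (n : ℕ) (q : ℝ) (h : RN n → ℝ) (x y : RN n) : ℝ≥0∞ :=
  ENNReal.ofReal ‖x - y‖ *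
    ⨆ (c : RN n) (r : ℝ) (_ : 0 < r) (_ : x ∈ Metric.closedBall c r)
      (_ : y ∈ Metric.closedBall c r),
      ((∫⁻ u in Metric.closedBall c r, ENNReal.ofReal (h u) ^ q) /
        volume (Metric.closedBall c r)) ^ (1 / q)

/-- The geodesic distance `d_q(x,y : h)`: the infimum of `∑_{i<k} δ_q(zᵢ, zᵢ₊₁ : h)` over all
finite chains `z₀ = x, z₁, …, z_k = y`. (Only the values `z 0, …, z k` matter.) -/
def geoDist (n : ℕ) (q : ℝ) (h : RN n → ℝ) (x y : RN n) : ℝ≥0∞ :=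
  ⨅ (k : ℕ) (z : ℕ → RN n) (_ : z 0 = x) (_ : z k = y),
    ∑ i ∈ Finset.range k, preDist n q h (z i) (z (i + 1))

/-- `D_{p,q} = { d_q(h) : h ∈ L_p(ℝⁿ), h ≥ 0 }`. -/
def DPQ (n : ℕ) (p q : ℝ) : Set (RN n → RN n → ℝ≥0∞) :=
  {d | ∃ h : RN n → ℝ, MemLp h (ENNReal.ofReal p) volume ∧ (∀ u, 0 ≤ h u) ∧ d = geoDist n q h}

/-! ### Multi-indices, partial derivatives, Taylor polynomials -/

/-- The multi-indices `α` with `|α| = k`. -/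
def multiIndexEq (n k : ℕ) : Finset (Fin n → ℕ) := Finset.piAntidiag Finset.univ k

/-- The multi-indices `α` with `|α| ≤ m`. -/
def multiIndexLE (n m : ℕ) : Finset (Fin n → ℕ) :=
  (Finset.range (m + 1)).biUnion (multiIndexEq n)

theorem mem_multiIndexEq {n k : ℕ} {α : Fin n → ℕ} : α ∈ multiIndexEq n k ↔ ∑ i, α i = k := by
  simp [multiIndexEq]

theorem mem_multiIndexLE {n m : ℕ} {α : Fin n → ℕ} : α ∈ multiIndexLE n m ↔ ∑ i, α i ≤ m := by
  simp [multiIndexLE, mem_multiIndexEq]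

/-- The partial derivative `D^α F(x)` of a function of class `C^{|α|}`: the `|α|`-th derivative of
`F` at `x`, applied to `α₀` copies of the basis vector `e₀`, then `α₁` copies of `e₁`, and so on. -/
def partialD {n : ℕ} (α : Fin n → ℕ) (F : RN n → ℝ) (x : RN n) : ℝ :=
  iteratedFDeriv ℝ (∑ i, α i) F x
    (fun j => Pi.single (finSigmaFinEquiv.symm j).1 (1 : ℝ))

/-- The Taylor polynomial `T^m_x[F](y) = ∑_{|α| ≤ m} D^α F(x) / α! * (y - x)^α`. -/
def taylorPoly {n : ℕ} (m : ℕ) (F : RN n → ℝ) (x : RN n) : MvPolynomial (Fin n) ℝ :=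
  ∑ α ∈ multiIndexLE n m,
    MvPolynomial.C (partialD α F x / ((∏ i, (α i).factorial : ℕ) : ℝ)) *
      ∏ i, (MvPolynomial.X i - MvPolynomial.C (x i)) ^ α i

/-- The function on `ℝⁿ` defined by a polynomial. -/
def polyFun {n : ℕ} (P : MvPolynomial (Fin n) ℝ) : RN n → ℝ := fun y => MvPolynomial.eval y P

/-! ### The spaces `C^{m,(d)}` -/

/-- `F` is Lipschitz with respect to `d`. -/
def IsLip {n : ℕ} (d : RN n → RN n → ℝ≥0∞) (F : RN n → ℝ) : Prop :=
  ∃ K : ℝ≥0, ∀ x y, ENNReal.ofReal |F x - F y| ≤ K * d x y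

/-- `‖F‖_{Lip(ℝⁿ; d)} = sup_{x ≠ y} |F(x) - F(y)| / d(x,y)`, with `0 / 0 = 0` and `a / 0 = ∞` for
`a > 0`. -/
def lipNorm {n : ℕ} (d : RN n → RN n → ℝ≥0∞) (F : RN n → ℝ) : ℝ≥0∞ :=
  ⨆ (x : RN n) (y : RN n) (_ : x ≠ y), ENNReal.ofReal |F x - F y| / d x y

/-- `C^{m,(d)}(ℝⁿ)`: the `C^m` functions whose partial derivatives of order `m` are Lipschitz with
respect to `d`. -/
def CMd {n : ℕ} (m : ℕ) (d : RN n → RN n → ℝ≥0∞) : Set (RN n → ℝ) :=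
  {F | ContDiff ℝ m F ∧ ∀ α ∈ multiIndexEq n m, IsLip d (partialD α F)}

/-- `‖F‖_{C^{m,(d)}} = ∑_{|α| = m} ‖D^α F‖_{Lip(ℝⁿ; d)}`. -/
def cmdNorm {n : ℕ} (m : ℕ) (d : RN n → RN n → ℝ≥0∞) (F : RN n → ℝ) : ℝ≥0∞ :=
  ∑ α ∈ multiIndexEq n m, lipNorm d (partialD α F)

/-! ### Whitney fields -/

/-- A Whitney `m`-field on `E`: a family `(P_x)_{x ∈ E}` of polynomials of degree at most `m`. -/
abbrev WhitneyField {n : ℕ} (m : ℕ) (E : Set (RN n)) : Type :=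
  E → MvPolynomial.restrictTotalDegree (Fin n) ℝ m

/-- `F` agrees with the field `P` on `E`: `T^m_x[F] = P_x` for every `x ∈ E`. -/
def AgreesWith {n m : ℕ} {E : Set (RN n)} (F : RN n → ℝ) (P : WhitneyField m E) : Prop :=
  ∀ x : E, taylorPoly m F x = (P x : MvPolynomial (Fin n) ℝ)

/-- `L_{m,d}(P) = sup_{x ≠ y in E} ∑_{|α| ≤ m} |D^α P_x(x) - D^α P_y(x)| / (‖x-y‖^{m-|α|} d(x,y))`,
with `0 / 0 = 0` and `a / 0 = ∞` for `a > 0`. -/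
def fieldNorm {n m : ℕ} {E : Set (RN n)} (d : RN n → RN n → ℝ≥0∞) (P : WhitneyField m E) : ℝ≥0∞ :=
  ⨆ (x : E) (y : E) (_ : x ≠ y), ∑ α ∈ multiIndexLE n m,
    ENNReal.ofReal |partialD α (polyFun (P x)) x - partialD α (polyFun (P y)) x| /
      (ENNReal.ofReal (‖(x : RN n) - y‖ ^ (m - ∑ i, α i)) * d x y)

/-- The infimum of `‖F‖_{C^{m,(d)}}` over all `F ∈ C^{m,(d)}(ℝⁿ)` that agree with `P` on `E`
(`∞` if there are none). -/
def extNorm {n m : ℕ} {E : Set (RN n)} (d : RN n → RN n → ℝ≥0∞) (P : WhitneyField m E) : ℝ≥0∞ :=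
  ⨅ (F : RN n → ℝ) (_ : F ∈ CMd m d) (_ : AgreesWith F P), cmdNorm m d F

end WhitneyJet

end

/-!
The proof has two independent ingredients: the comparison of the geodesic distance `d = d_q(h)` with
the explicit pre-distance `δ = δ_q(h)`, and a Whitney extension theorem for jets controlled by a
distance with a simple growth property.

**The distance.** Enlarging a cube of half-side `r` to a concentric one of half-side `R` lowers the
mean `(|Q|⁻¹ ∫_Q h^q)^{1/q}` at most by the factor `(r/R)^{n/q} ≥ r/R`, because `n ≤ q`. Hence
`‖x - y‖ δ(z,w) ≤ (‖z - w‖ + 2T) δ(x,y)` if `x` and `y` lie within `T` of `z` (`preDist_growth`).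
The same fact gives `d ≤ δ ≤ 5 d` (`preDist_le_geoDist`): for a cube `Q ∋ x, y`, the function
`z ↦ min ‖z - x‖ ‖x - y‖` times the mean over `Q` is Lipschitz with constant `5` for `δ`, and its
increments along a chain from `x` to `y` add up to `‖x - y‖` times the mean. Hölder's inequality
with `h ∈ L_p`, `p > n`, yields `δ(x,y) ≤ K ‖x - y‖^{1 - n/p}`, so `δ` is finite and continuous on
the diagonal. From here on only these properties of `δ` are used (`IsGrowthDist`).

**Restriction.** If `F` agrees with the field `P`, then `F - P_y` has vanishing derivatives up to
order `m` at `y`, and its derivatives of order `m` on the ball of radius `‖x - y‖` about `y` are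
bounded by a multiple of `‖F‖ δ(x,y)`, by the growth property. Integrating down with the mean value
inequality (`norm_iteratedFDeriv_le_of_bounds`) bounds `D^α(F - P_y)(x) = D^α(P_x - P_y)(x)`.

**Extension.** Off `E`, the polynomials are glued by a partition of unity `φ_i` adapted to grid
cubes of side comparable to their distance to `E` (`exists_whitney_partition`): `F = ∑ φ_i P_{a_i}`
with `a_i ∈ E` near the `i`-th cube. Writing `F - P_a = ∑ φ_i (P_{a_i} - P_a)` for a point `a ∈ E`
nearest to `x`, the Leibniz rule bounds `D^k(F - P_a)(x)` by a multiple of `dist(x,E)^{m-k} δ(x,a)`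
for all `k ≤ m + 1` (`exists_extension_off`). For `k ≤ m` this extends to all `a ∈ E`
(`norm_gluedJet_sub_le`), and since `δ(x,a) → 0` as `x → a`, the jets of `P_x` on `E` and of `F` off
`E` form the Taylor series of a `C^m` function (`hasFTaylorSeriesUpTo_gluedJet`). For the Lipschitz
estimate of order `m` (`norm_gluedJet_sub_gluedJet_le`), points `x, y` with `2 ‖x - y‖ < dist(x,E)`
are treated by the case `k = m + 1`, the growth property turning `‖x - y‖ δ(z,a) / dist(z,E)` into
`δ(x,y)`; other points are compared through the polynomials of nearest points of `E`.

Derivatives are measured throughout by the norms of the multilinear maps `iteratedFDeriv`. The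
passage to partial derivatives rests on the symmetry of higher derivatives of `C^k` functions
(`iteratedFDeriv_comp_perm_of_contDiff`), and Taylor polynomials are identified by their
coefficients after translation of the centre to the origin (`coeff_translatePoly`).
-/

namespace WhitneyJet

/-! ### The pre-distance `δ_q(h)` and the geodesic distance `d_q(h)` -/

/-- The mean `(|Q|⁻¹ ∫_Q h^q)^{1/q}` over the cube `Q` with centre `c` and half-side `r`. -/
noncomputable def cubeMean (n : ℕ) (q : ℝ) (h : RN n → ℝ) (c : RN n) (r : ℝ) : ℝ≥0∞ :=
  ((∫⁻ u in Metric.closedBall c r, ENNReal.ofReal (h u) ^ q) /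
    volume (Metric.closedBall c r)) ^ (1 / q)

theorem mul_cubeMean_le_preDist {n : ℕ} (q : ℝ) (h : RN n → ℝ) {x y c : RN n} {r : ℝ}
    (hr : 0 < r) (hx : x ∈ Metric.closedBall c r) (hy : y ∈ Metric.closedBall c r) :
    ENNReal.ofReal ‖x - y‖ * cubeMean n q h c r ≤ preDist n q h x y := by
  unfold preDist
  gcongr
  exact le_iSup_of_le c <| le_iSup_of_le r <| le_iSup_of_le hr <| le_iSup_of_le hx <|
    le_iSup_of_le hy le_rfl

theorem mul_preDist_le {n : ℕ} {q : ℝ} {h : RN n → ℝ} {x y : RN n} {a b : ℝ≥0∞}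
    (H : ∀ c r, 0 < r → x ∈ Metric.closedBall c r → y ∈ Metric.closedBall c r →
      a * (ENNReal.ofReal ‖x - y‖ * cubeMean n q h c r) ≤ b) :
    a * preDist n q h x y ≤ b := by
  unfold preDist
  simp only [ENNReal.mul_iSup, iSup_le_iff]
  exact H

theorem preDist_symm {n : ℕ} (q : ℝ) (h : RN n → ℝ) (x y : RN n) :
    preDist n q h x y = preDist n q h y x := by
  have key : ∀ x y, preDist n q h x y ≤ preDist n q h y x := by
    intro x y
    have := mul_preDist_le (n := n) (q := q) (h := h) (x := x) (y := y) (a := 1)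
      (b := preDist n q h y x) (fun c r hr hx hy => by
        rw [one_mul, norm_sub_rev]; exact mul_cubeMean_le_preDist q h hr hy hx)
    simpa using this
  exact le_antisymm (key x y) (key y x)

/-- Enlarging a cube about its centre lowers the mean at most by the ratio of the sides. Here
`n ≤ q` is used. -/
theorem cubeMean_mul_le {n : ℕ} {q : ℝ} (hq : 0 < q) (hnq : (n : ℝ) ≤ q) (h : RN n → ℝ)
    (c : RN n) {r R : ℝ} (hr : 0 < r) (hR : r ≤ R) :
    cubeMean n q h c r * ENNReal.ofReal (r / R) ≤ cubeMean n q h c R := by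
  have hR0 : 0 < R := hr.trans_le hR
  have h1 : ENNReal.ofReal (r / R) ≤ 1 := by
    rw [ENNReal.ofReal_le_one]; exact (div_le_one hR0).2 hR
  have hvol : ∀ s : ℝ, 0 < s →
      volume (Metric.closedBall c s) = ENNReal.ofReal (2 * s) ^ n := by
    intro s hs
    rw [Real.volume_pi_closedBall c hs.le, ENNReal.ofReal_pow (by positivity), Fintype.card_fin]
  have h2 : ENNReal.ofReal (r / R) ≤ (ENNReal.ofReal (r / R) ^ n) ^ (1 / q) := by
    rw [← ENNReal.rpow_natCast, ← ENNReal.rpow_mul]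
    conv_lhs => rw [← ENNReal.rpow_one (ENNReal.ofReal (r / R))]
    apply ENNReal.rpow_le_rpow_of_exponent_ge h1
    rw [mul_one_div]
    exact (div_le_one hq).2 hnq
  calc cubeMean n q h c r * ENNReal.ofReal (r / R)
      ≤ cubeMean n q h c r * (ENNReal.ofReal (r / R) ^ n) ^ (1 / q) := by gcongr
    _ = ((∫⁻ u in Metric.closedBall c r, ENNReal.ofReal (h u) ^ q) /
          volume (Metric.closedBall c R)) ^ (1 / q) := by
        unfold cubeMean
        rw [← ENNReal.mul_rpow_of_nonneg _ _ (by positivity), hvol r hr, hvol R hR0]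
        congr 1
        have e : ENNReal.ofReal (r / R) = ENNReal.ofReal (2 * r) / ENNReal.ofReal (2 * R) := by
          rw [← ENNReal.ofReal_div_of_pos (by positivity)]
          congr 1; field_simp
        rw [e, div_eq_mul_inv, div_eq_mul_inv, div_eq_mul_inv, mul_pow, mul_assoc,
          ← mul_assoc (ENNReal.ofReal (2 * r) ^ n)⁻¹,
          ENNReal.inv_mul_cancel (pow_ne_zero _ (by simpa using hr))
            (ENNReal.pow_ne_top ENNReal.ofReal_ne_top), one_mul, ENNReal.inv_pow]
    _ ≤ cubeMean n q h c R := by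
        unfold cubeMean
        gcongr

theorem mul_cubeMean_mul_le_preDist {n : ℕ} {q : ℝ} (hq : 0 < q) (hnq : (n : ℝ) ≤ q)
    (h : RN n → ℝ) {z w c : RN n} {r R : ℝ} (hr : 0 < r) (hR : r ≤ R)
    (hz : z ∈ Metric.closedBall c R) (hw : w ∈ Metric.closedBall c R) :
    ENNReal.ofReal ‖z - w‖ * (cubeMean n q h c r * ENNReal.ofReal (r / R)) ≤
      preDist n q h z w := by
  refine le_trans ?_ (mul_cubeMean_le_preDist q h (hr.trans_le hR) hz hw)
  gcongr
  exact cubeMean_mul_le hq hnq h c hr hR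

/-- If `x` and `y` lie within `T` of `z`, then `δ(z,w) / ‖z - w‖` exceeds `δ(x,y) / ‖x - y‖` at
most by the factor `1 + 2T / ‖z - w‖`. -/
theorem preDist_growth {n : ℕ} {q : ℝ} (hq : 0 < q) (hnq : (n : ℝ) ≤ q) (h : RN n → ℝ)
    {x y z w : RN n} {T : ℝ} (hx : ‖x - z‖ ≤ T) (hy : ‖y - z‖ ≤ T) :
    ENNReal.ofReal ‖x - y‖ * preDist n q h z w ≤
      ENNReal.ofReal (‖z - w‖ + 2 * T) * preDist n q h x y := by
  have hT : 0 ≤ T := (norm_nonneg _).trans hx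
  refine mul_preDist_le fun c r hr hz hw => ?_
  rw [mem_closedBall_iff_norm] at hz hw
  have hs : ‖z - w‖ ≤ 2 * r := by
    have := norm_sub_le (z - c) (w - c)
    rw [sub_sub_sub_cancel_right] at this
    linarith
  have hb : ∀ u : RN n, ‖u - z‖ ≤ T → u ∈ Metric.closedBall c (r + T) := by
    intro u hu
    rw [mem_closedBall_iff_norm]
    have := norm_add_le (u - z) (z - c)
    rw [sub_add_sub_cancel] at this
    linarith
  have h1 := mul_cubeMean_mul_le_preDist hq hnq h hr (by linarith : r ≤ r + T) (hb x hx) (hb y hy)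
  have h2 : ‖z - w‖ ≤ (‖z - w‖ + 2 * T) * (r / (r + T)) := by
    rw [mul_div_assoc', le_div_iff₀ (by linarith)]
    nlinarith [mul_nonneg hT (sub_nonneg.2 hs)]
  calc ENNReal.ofReal ‖x - y‖ * (ENNReal.ofReal ‖z - w‖ * cubeMean n q h c r)
      ≤ ENNReal.ofReal ‖x - y‖ * (ENNReal.ofReal ((‖z - w‖ + 2 * T) * (r / (r + T))) *
          cubeMean n q h c r) := by gcongr
    _ = ENNReal.ofReal (‖z - w‖ + 2 * T) * (ENNReal.ofReal ‖x - y‖ *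
          (cubeMean n q h c r * ENNReal.ofReal (r / (r + T)))) := by
        rw [ENNReal.ofReal_mul (by positivity)]; ring
    _ ≤ _ := by gcongr

theorem geoDist_le_preDist {n : ℕ} (q : ℝ) (h : RN n → ℝ) (x y : RN n) :
    geoDist n q h x y ≤ preDist n q h x y := by
  unfold geoDist
  refine iInf_le_of_le 1 <| iInf_le_of_le (fun i => if i = 0 then x else y) <|
    iInf_le_of_le (by simp) <| iInf_le_of_le (by simp) ?_
  simp

/-- The pre-distance is at most five times the geodesic distance. For a cube `Q` containing `x`
and `y`, the truncated distance `z ↦ min ‖z - x‖ ‖x - y‖` to `x`, multiplied by the mean of `h`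
over `Q`, is Lipschitz with constant `5` for the pre-distance; its increments along a chain from
`x` to `y` are then summed. -/
theorem preDist_le_geoDist {n : ℕ} {q : ℝ} (hq : 0 < q) (hnq : (n : ℝ) ≤ q) (h : RN n → ℝ)
    (x y : RN n) : preDist n q h x y ≤ 5 * geoDist n q h x y := by
  rw [← one_mul (preDist n q h x y)]
  refine mul_preDist_le fun c r hr hx hy => ?_
  rw [one_mul]
  rw [mem_closedBall_iff_norm] at hx hy
  set A := cubeMean n q h c r
  have hρ : ‖x - y‖ ≤ 2 * r := by
    have := norm_sub_le (x - c) (y - c)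
    rw [sub_sub_sub_cancel_right] at this
    linarith
  -- The concentric cube of half-side `3 * r + ‖z - w‖` contains `z` and `w`.
  have key : ∀ z w : RN n, ‖z - x‖ ≤ ‖x - y‖ →
      ENNReal.ofReal (min ‖z - w‖ ‖x - y‖) * A ≤ 5 * preDist n q h z w := by
    intro z w hz
    have hzc : ‖z - c‖ ≤ 3 * r := by
      have := norm_add_le (z - x) (x - c)
      rw [sub_add_sub_cancel] at this
      linarith
    have hwc : ‖w - c‖ ≤ 3 * r + ‖z - w‖ := by
      have := norm_sub_le (z - c) (z - w)
      rw [sub_sub_sub_cancel_left] at this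
      linarith
    have h1 := mul_cubeMean_mul_le_preDist (R := 3 * r + ‖z - w‖) hq hnq h hr
      (by linarith [norm_nonneg (z - w)])
      (mem_closedBall_iff_norm.2 (hzc.trans (by linarith [norm_nonneg (z - w)])))
      (mem_closedBall_iff_norm.2 hwc)
    have h2 : min ‖z - w‖ ‖x - y‖ ≤ 5 * (‖z - w‖ * (r / (3 * r + ‖z - w‖))) := by
      rw [mul_div_assoc', mul_div_assoc', le_div_iff₀ (by linarith [norm_nonneg (z - w)])]
      nlinarith [mul_le_mul_of_nonneg_right (min_le_left ‖z - w‖ ‖x - y‖) hr.le,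
        mul_le_mul_of_nonneg_right ((min_le_right ‖z - w‖ ‖x - y‖).trans hρ)
          (norm_nonneg (z - w))]
    calc ENNReal.ofReal (min ‖z - w‖ ‖x - y‖) * A
        ≤ ENNReal.ofReal (5 * (‖z - w‖ * (r / (3 * r + ‖z - w‖)))) * A := by gcongr
      _ = 5 * (ENNReal.ofReal ‖z - w‖ *
            (A * ENNReal.ofReal (r / (3 * r + ‖z - w‖)))) := by
          rw [ENNReal.ofReal_mul (by norm_num), ENNReal.ofReal_mul (norm_nonneg _),
            ENNReal.ofReal_ofNat]
          ring
      _ ≤ _ := by gcongr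
  have key2 : ∀ z w : RN n,
      ENNReal.ofReal |min ‖z - x‖ ‖x - y‖ - min ‖w - x‖ ‖x - y‖| * A ≤
        5 * preDist n q h z w := by
    intro z w
    have hm : ∀ z w : RN n, ‖z - x‖ ≤ ‖x - y‖ →
        |min ‖z - x‖ ‖x - y‖ - min ‖w - x‖ ‖x - y‖| ≤ min ‖z - w‖ ‖x - y‖ := by
      intro z w hz
      refine le_min ?_ ?_
      · have := abs_min_sub_min_le_max (‖z - x‖) ‖x - y‖ (‖w - x‖) ‖x - y‖
        rw [sub_self, abs_zero, max_eq_left (abs_nonneg _)] at this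
        refine this.trans ?_
        have := abs_norm_sub_norm_le (z - x) (w - x)
        rwa [sub_sub_sub_cancel_right] at this
      · rw [abs_sub_le_iff]
        constructor <;>
        linarith [le_min (norm_nonneg (z - x)) (norm_nonneg (x - y)),
          le_min (norm_nonneg (w - x)) (norm_nonneg (x - y)),
          min_le_right ‖z - x‖ ‖x - y‖, min_le_right ‖w - x‖ ‖x - y‖]
    by_cases hz : ‖z - x‖ ≤ ‖x - y‖
    · refine le_trans ?_ (key z w hz)
      gcongr
      exact hm z w hz
    · by_cases hw : ‖w - x‖ ≤ ‖x - y‖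
      · rw [preDist_symm, abs_sub_comm]
        refine le_trans ?_ (key w z hw)
        gcongr
        exact hm w z hw
      · rw [min_eq_right (not_le.1 hz).le, min_eq_right (not_le.1 hw).le]
        simp
  have hfin : (ENNReal.ofReal ‖x - y‖ * A) / 5 ≤ geoDist n q h x y := by
    refine le_iInf fun k => le_iInf fun z => le_iInf fun h0 => le_iInf fun hk => ?_
    rw [ENNReal.div_le_iff (by norm_num) (by norm_num)]
    have tel : ∀ j : ℕ, ENNReal.ofReal |min ‖z 0 - x‖ ‖x - y‖ - min ‖z j - x‖ ‖x - y‖| * A ≤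
        (∑ i ∈ Finset.range j, preDist n q h (z i) (z (i + 1))) * 5 := by
      intro j
      induction j with
      | zero => simp
      | succ j ih =>
        rw [Finset.sum_range_succ, add_mul]
        refine le_trans ?_ (add_le_add ih ((key2 (z j) (z (j + 1))).trans (mul_comm _ _).le))
        rw [← add_mul, ← ENNReal.ofReal_add (abs_nonneg _) (abs_nonneg _)]
        gcongr
        exact abs_sub_le _ _ _
    have := tel k
    rw [h0, hk, sub_self, norm_zero, min_eq_left (norm_nonneg _), norm_sub_rev y x, min_self,
      zero_sub, abs_neg, abs_of_nonneg (norm_nonneg _)] at this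
    exact this
  rwa [ENNReal.div_le_iff (by norm_num) (by norm_num), mul_comm (geoDist n q h x y)] at hfin

/-- Hölder's inequality bounds the pre-distance of a function in `L_p` by a multiple of
`‖x - y‖^{1 - n/p}`. -/
theorem exists_preDist_le {n : ℕ} {p q : ℝ} (hq : 0 < q) (hqp : q < p) {h : RN n → ℝ}
    (hh : MemLp h (ENNReal.ofReal p) volume) (h0 : ∀ u, 0 ≤ h u) :
    ∃ K : ℝ≥0∞, K ≠ ∞ ∧ ∀ x y,
      preDist n q h x y ≤
        K * (ENNReal.ofReal ‖x - y‖ * ENNReal.ofReal (‖x - y‖ ^ n) ^ (-(1 / p))) := by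
  have hp : 0 < p := hq.trans hqp
  refine ⟨eLpNorm' h p volume, ?_, fun x y => ?_⟩
  · have := hh.2
    rw [eLpNorm_eq_eLpNorm' (by simpa using hp) ENNReal.ofReal_ne_top,
      ENNReal.toReal_ofReal hp.le] at this
    exact this.ne
  rw [← one_mul (preDist n q h x y)]
  refine mul_preDist_le fun c r hr hx hy => ?_
  rw [one_mul, mul_left_comm]
  gcongr
  rw [mem_closedBall_iff_norm] at hx hy
  have hρ : ‖x - y‖ ≤ 2 * r := by
    have := norm_sub_le (x - c) (y - c)
    rw [sub_sub_sub_cancel_right] at this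
    linarith
  have hvol : volume (Metric.closedBall c r) = ENNReal.ofReal ((2 * r) ^ n) := by
    rw [Real.volume_pi_closedBall c hr.le, Fintype.card_fin]
  set B := Metric.closedBall c r
  have hB0 : volume B ≠ 0 := by rw [hvol]; simp; positivity
  have hBt : volume B ≠ ∞ := by rw [hvol]; exact ENNReal.ofReal_ne_top
  have e1 : cubeMean n q h c r = eLpNorm' h q (volume.restrict B) / volume B ^ (1 / q) := by
    unfold cubeMean eLpNorm'
    rw [ENNReal.div_rpow_of_nonneg _ _ (by positivity)]
    simp only [Real.enorm_of_nonneg (h0 _)]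
    rfl
  have e2 := eLpNorm'_le_eLpNorm'_mul_rpow_measure_univ hq hqp.le
    (hh.1.restrict (s := B))
  rw [Measure.restrict_apply_univ] at e2
  calc cubeMean n q h c r
      ≤ (eLpNorm' h p (volume.restrict B) * volume B ^ (1 / q - 1 / p)) /
          volume B ^ (1 / q) := by rw [e1]; gcongr
    _ = eLpNorm' h p (volume.restrict B) * volume B ^ (-(1 / p)) := by
        rw [mul_div_assoc, ← ENNReal.rpow_sub _ _ hB0 hBt]
        congr 2; ring
    _ ≤ eLpNorm' h p volume * ENNReal.ofReal (‖x - y‖ ^ n) ^ (-(1 / p)) := by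
        gcongr ?_ * ?_
        · exact eLpNorm'_mono_measure h Measure.restrict_le_self hp.le
        · rw [ENNReal.rpow_neg, ENNReal.rpow_neg, hvol]
          gcongr

/-- The properties of a pre-distance that govern the extension of jets: it is finite, symmetric
and continuous on the diagonal, and `ρ(x,y) / ‖x - y‖` is almost decreasing in the sense of
`preDist_growth`. -/
structure IsGrowthDist {n : ℕ} (ρ : RN n → RN n → ℝ) : Prop where
  nonneg : ∀ x y, 0 ≤ ρ x y
  symm : ∀ x y, ρ x y = ρ y x
  growth : ∀ (x y z w : RN n) (T : ℝ), ‖x - z‖ ≤ T → ‖y - z‖ ≤ T →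
    ‖x - y‖ * ρ z w ≤ (‖z - w‖ + 2 * T) * ρ x y
  tendsto : ∀ a, Filter.Tendsto (fun x => ρ x a) (nhds a) (nhds 0)

theorem exists_isGrowthDist {n : ℕ} {p q : ℝ} (hn : 1 ≤ n) (hnq : (n : ℝ) < q) (hqp : q < p)
    {d : RN n → RN n → ℝ≥0∞} (hd : d ∈ DPQ n p q) :
    ∃ ρ : RN n → RN n → ℝ, IsGrowthDist ρ ∧
      ∀ x y, d x y ≤ ENNReal.ofReal (ρ x y) ∧ ENNReal.ofReal (ρ x y) ≤ 5 * d x y := by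
  obtain ⟨h, hh, h0, rfl⟩ := hd
  have hn0 : (0 : ℝ) < n := by exact_mod_cast hn
  have hq : 0 < q := hn0.trans hnq
  have hp : 0 < p := hq.trans hqp
  obtain ⟨K, hK, hle⟩ := exists_preDist_le hq hqp hh h0
  have hle' : ∀ x y, preDist n q h x y ≤ K * ENNReal.ofReal (‖x - y‖ ^ (1 - n / p)) := by
    intro x y
    refine (hle x y).trans ?_
    gcongr
    rcases eq_or_lt_of_le (norm_nonneg (x - y)) with h | h
    · rw [← h]; simp
    · rw [ENNReal.ofReal_rpow_of_pos (by positivity), ← ENNReal.ofReal_mul h.le]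
      refine ENNReal.ofReal_le_ofReal (le_of_eq ?_)
      rw [← Real.rpow_natCast, ← Real.rpow_mul h.le]
      conv_lhs => rw [← Real.rpow_one ‖x - y‖]
      rw [Real.rpow_one, mul_comm, ← Real.rpow_add_one h.ne']
      congr 1; ring
  have hfin : ∀ x y, preDist n q h x y ≠ ∞ := fun x y =>
    ((hle' x y).trans_lt (ENNReal.mul_lt_top hK.lt_top ENNReal.ofReal_lt_top)).ne
  refine ⟨fun x y => (preDist n q h x y).toReal, ⟨fun _ _ => ENNReal.toReal_nonneg,
    fun x y => by rw [preDist_symm], fun x y z w T hx hy => ?_, fun a => ?_⟩, fun x y => ?_⟩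
  · have hT : 0 ≤ T := (norm_nonneg _).trans hx
    have := preDist_growth (w := w) hq hnq.le h hx hy
    have := ENNReal.toReal_mono (ENNReal.mul_ne_top ENNReal.ofReal_ne_top (hfin x y)) this
    rwa [ENNReal.toReal_mul, ENNReal.toReal_mul, ENNReal.toReal_ofReal (norm_nonneg _),
      ENNReal.toReal_ofReal (by positivity)] at this
  · have hexp : 0 < 1 - n / p := by
      rw [sub_pos, div_lt_one hp]; exact hnq.trans hqp
    have hlim : Filter.Tendsto (fun x : RN n => K.toReal * ‖x - a‖ ^ (1 - n / p))
        (nhds a) (nhds 0) := by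
      have : Continuous (fun x : RN n => K.toReal * ‖x - a‖ ^ (1 - n / p)) :=
        continuous_const.mul ((continuous_id.sub continuous_const).norm.rpow_const
          fun _ => Or.inr hexp.le)
      simpa [Real.zero_rpow hexp.ne'] using this.tendsto a
    refine squeeze_zero (fun _ => ENNReal.toReal_nonneg) (fun x => ?_) hlim
    have := ENNReal.toReal_mono (ENNReal.mul_ne_top hK ENNReal.ofReal_ne_top) (hle' x a)
    rwa [ENNReal.toReal_mul, ENNReal.toReal_ofReal (by positivity)] at this
  · simp only [ENNReal.ofReal_toReal (hfin x y)]
    exact ⟨geoDist_le_preDist q h x y, preDist_le_geoDist hq hnq.le h x y⟩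

/-! ### Symmetry of higher derivatives -/

theorem iteratedFDeriv_succ_apply_last {E : Type*} [NormedAddCommGroup E] [NormedSpace ℝ E]
    {k : ℕ} {f : E → ℝ} (hf : ContDiff ℝ (k + 1 : ℕ) f) (x : E) (v : Fin (k + 1) → E) :
    iteratedFDeriv ℝ (k + 1) f x v =
      iteratedFDeriv ℝ k (fun y => fderiv ℝ f y (v (Fin.last k))) x (Fin.init v) := by
  rw [iteratedFDeriv_succ_apply_right]
  have h : ContDiff ℝ (k : ℕ) (fderiv ℝ f) := hf.fderiv_right (by norm_cast)
  rw [iteratedFDeriv_clm_apply_const_apply h le_rfl]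

/-- Exchanging two adjacent arguments leaves the derivative unchanged. By induction on the order,
splitting off the last argument; only the exchange of the last two arguments needs the symmetry of
the second derivative. -/
theorem iteratedFDeriv_comp_swap {E : Type*} [NormedAddCommGroup E] [NormedSpace ℝ E] (k : ℕ) :
    ∀ {f : E → ℝ}, ContDiff ℝ (k + 1 : ℕ) f → ∀ (x : E) (v : Fin (k + 1) → E) (j : Fin k),
      iteratedFDeriv ℝ (k + 1) f x (v ∘ Equiv.swap j.castSucc j.succ) =
        iteratedFDeriv ℝ (k + 1) f x v := by
  induction k with
  | zero => intro f _ x v j; exact j.elim0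
  | succ k ih =>
    intro f hf x v j
    have hg : ∀ w : E, ContDiff ℝ (k + 1 : ℕ) (fun y => fderiv ℝ f y w) := fun w =>
      (hf.fderiv_right (by norm_cast)).clm_apply contDiff_const
    rw [iteratedFDeriv_succ_apply_last hf, iteratedFDeriv_succ_apply_last hf]
    induction j using Fin.lastCases with
    | last =>
      -- The last two slots are exchanged by the symmetry of the second derivative.
      rw [iteratedFDeriv_succ_apply_last (hg _), iteratedFDeriv_succ_apply_last (hg _)]
      have h2 : ∀ y a b, fderiv ℝ (fun y => fderiv ℝ f y a) y b =
          fderiv ℝ (fun y => fderiv ℝ f y b) y a := by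
        intro y a b
        have hd : DifferentiableAt ℝ (fderiv ℝ f) y :=
          ((hf.fderiv_right (m := (k + 1 : ℕ)) (by norm_cast)).differentiable (by simp)) y
        have hs : IsSymmSndFDerivAt ℝ f y := hf.contDiffAt.isSymmSndFDerivAt (by
          rw [minSmoothness_of_isRCLikeNormedField]
          exact_mod_cast Nat.le_add_left 2 k)
        have e : ∀ a b, fderiv ℝ (fun y => fderiv ℝ f y a) y b =
            fderiv ℝ (fderiv ℝ f) y b a := by
          intro a b
          rw [fderiv_clm_apply hd (differentiableAt_const a)]
          simp
        rw [e, e]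
        exact hs.eq _ _
      have e1 : (v ∘ Equiv.swap (Fin.last k).castSucc (Fin.last k).succ) (Fin.last (k + 1)) =
          Fin.init v (Fin.last k) := by
        rw [Function.comp_apply, ← Fin.succ_last, Equiv.swap_apply_right]; rfl
      have e2 : Fin.init (v ∘ Equiv.swap (Fin.last k).castSucc (Fin.last k).succ) (Fin.last k) =
          v (Fin.last (k + 1)) := by
        rw [Fin.init, Function.comp_apply, Equiv.swap_apply_left, Fin.succ_last]
      have e3 : Fin.init (Fin.init (v ∘ Equiv.swap (Fin.last k).castSucc (Fin.last k).succ)) =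
          Fin.init (Fin.init v) := by
        funext i
        simp only [Fin.init, Function.comp_apply]
        congr 1
        apply Equiv.swap_apply_of_ne_of_ne
        · intro h
          have := congrArg Fin.val h
          simp at this
          omega
        · intro h
          have := congrArg Fin.val h
          simp at this
          omega
      rw [e1, e2, e3]
      congr 2
      funext y
      exact h2 y _ _
    | cast j =>
      have e1 : (v ∘ Equiv.swap j.castSucc.castSucc j.castSucc.succ) (Fin.last (k + 1)) =
          v (Fin.last (k + 1)) := by
        rw [Function.comp_apply]
        congr 1
        apply Equiv.swap_apply_of_ne_of_ne
        · intro h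
          have := congrArg Fin.val h
          simp at this
          omega
        · intro h
          have := congrArg Fin.val h
          simp at this
          omega
      have e2 : Fin.init (v ∘ Equiv.swap j.castSucc.castSucc j.castSucc.succ) =
          Fin.init v ∘ Equiv.swap j.castSucc j.succ := by
        funext i
        simp only [Fin.init, Function.comp_apply]
        congr 1
        rw [← Fin.castSucc_succ]
        exact (Fin.castSucc_injective _).map_swap _ _ _ |>.symm
      rw [e1, e2]
      exact ih (hg _) x _ j

/-- The `k`-th derivative of a real-valued function of class `C^k` is symmetric. -/
theorem iteratedFDeriv_comp_perm_of_contDiff {E : Type*} [NormedAddCommGroup E] [NormedSpace ℝ E]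
    {k : ℕ} {f : E → ℝ} (hf : ContDiff ℝ k f) (x : E) (v : Fin k → E)
    (σ : Equiv.Perm (Fin k)) :
    iteratedFDeriv ℝ k f x (v ∘ σ) = iteratedFDeriv ℝ k f x v := by
  cases k with
  | zero => congr 1; exact Subsingleton.elim _ _
  | succ k =>
    have hσ : σ ∈ Submonoid.closure
        (Set.range fun i : Fin k => Equiv.swap i.castSucc i.succ) := by
      rw [Equiv.Perm.mclosure_swap_castSucc_succ]; trivial
    induction hσ using Submonoid.closure_induction generalizing v with
    | mem s hs =>
      obtain ⟨j, rfl⟩ := hs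
      exact iteratedFDeriv_comp_swap k hf x v j
    | one => rfl
    | mul s t _ _ h1 h2 =>
      rw [Equiv.Perm.coe_mul, ← Function.comp_assoc, h2, h1]

/-! ### Multi-indices and derivatives along basis vectors -/

/-- The multi-index counting how often each coordinate direction occurs in the tuple `i`. -/
noncomputable def tupleCount {n k : ℕ} (i : Fin k → Fin n) : Fin n →₀ ℕ :=
  ∑ j, Finsupp.single (i j) 1

theorem tupleCount_apply {n k : ℕ} (i : Fin k → Fin n) (l : Fin n) :
    tupleCount i l = Fintype.card {j // i j = l} := by
  classical
  rw [tupleCount, Finsupp.finsetSum_apply, Fintype.card_subtype, Finset.card_filter]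
  simp [Finsupp.single_apply]

theorem sum_tupleCount {n k : ℕ} (i : Fin k → Fin n) : ∑ l, tupleCount i l = k := by
  simp only [tupleCount, Finsupp.finsetSum_apply]
  rw [Finset.sum_comm]
  simp [Finsupp.single_apply]

theorem tupleCount_succ {n k : ℕ} (i : Fin (k + 1) → Fin n) :
    tupleCount i = tupleCount (Fin.init i) + Finsupp.single (i (Fin.last k)) 1 := by
  rw [tupleCount, Fin.sum_univ_castSucc]; rfl

theorem tupleCount_finSigma {n : ℕ} (α : Fin n → ℕ) (l : Fin n) :
    tupleCount (fun j : Fin (∑ i, α i) => (finSigmaFinEquiv.symm j).1) l = α l := by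
  rw [tupleCount, Finsupp.finsetSum_apply,
    finSigmaFinEquiv.symm.sum_comp (fun s : (i : Fin n) × Fin (α i) => Finsupp.single s.1 1 l),
    Fintype.sum_sigma]
  simp [Finsupp.single_apply]

theorem exists_perm_of_tupleCount_eq {n k : ℕ} {i j : Fin k → Fin n}
    (h : tupleCount i = tupleCount j) : ∃ σ : Equiv.Perm (Fin k), j ∘ σ = i := by
  have e : ∀ l : Fin n, Nonempty ({a // i a = l} ≃ {a // j a = l}) := fun l =>
    ⟨Fintype.equivOfCardEq (by rw [← tupleCount_apply, ← tupleCount_apply, h])⟩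
  exact ⟨Equiv.ofFiberEquiv fun l => (e l).some, by
    funext a; exact Equiv.ofFiberEquiv_map _ a⟩

/-- By symmetry, a derivative along basis vectors depends only on the multi-index of the tuple. -/
theorem iteratedFDeriv_apply_single {n k : ℕ} {F : RN n → ℝ} (hF : ContDiff ℝ k F) (x : RN n)
    (i : Fin k → Fin n) :
    iteratedFDeriv ℝ k F x (fun j => Pi.single (i j) (1 : ℝ)) = partialD (tupleCount i) F x := by
  have main : ∀ α : Fin n → ℕ, ∑ l, α l = k → ∀ i : Fin k → Fin n, (∀ l, tupleCount i l = α l) →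
      iteratedFDeriv ℝ k F x (fun j => Pi.single (i j) (1 : ℝ)) = partialD α F x := by
    rintro α rfl i hi
    obtain ⟨σ, hσ⟩ := exists_perm_of_tupleCount_eq (i := i)
      (j := fun j : Fin (∑ i, α i) => (finSigmaFinEquiv.symm j).1)
      (Finsupp.ext fun l => by rw [hi, tupleCount_finSigma])
    rw [partialD, ← hσ, ← iteratedFDeriv_comp_perm_of_contDiff hF x
      (fun j => Pi.single (finSigmaFinEquiv.symm j).1 (1 : ℝ)) σ]
    rfl
  exact main _ (sum_tupleCount i) i fun _ => rfl

theorem abs_partialD_sub_le {n : ℕ} (α : Fin n → ℕ) (F G : RN n → ℝ) (x y : RN n) :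
    |partialD α F x - partialD α G y| ≤
      ‖iteratedFDeriv ℝ (∑ i, α i) F x - iteratedFDeriv ℝ (∑ i, α i) G y‖ := by
  have := (iteratedFDeriv ℝ (∑ i, α i) F x - iteratedFDeriv ℝ (∑ i, α i) G y).le_opNorm
    (fun j => Pi.single (finSigmaFinEquiv.symm j).1 (1 : ℝ))
  simpa [partialD, Pi.norm_single] using this

/-- A multilinear form bounded by `B` on tuples of basis vectors has norm at most `n^k * B`. -/
theorem norm_multilinear_le_of_single {n k : ℕ} (M : (RN n) [×k]→L[ℝ] ℝ) {B : ℝ}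
    (hB : ∀ i : Fin k → Fin n, |M (fun j => Pi.single (i j) (1 : ℝ))| ≤ B) (hB0 : 0 ≤ B) :
    ‖M‖ ≤ (n : ℝ) ^ k * B := by
  refine ContinuousMultilinearMap.opNorm_le_bound (by positivity) fun v => ?_
  have hv : v = fun j => ∑ l, v j l • (Pi.single l (1 : ℝ) : RN n) := by
    funext j
    rw [← pi_eq_sum_univ' (v j)]
  have hs : M v = ∑ i : Fin k → Fin n, (∏ j, v j (i j)) * M (fun j => Pi.single (i j) (1 : ℝ)) := by
    conv_lhs => rw [hv]
    rw [ContinuousMultilinearMap.map_sum]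
    refine Finset.sum_congr rfl fun i _ => ?_
    rw [ContinuousMultilinearMap.map_smul_univ, smul_eq_mul]
  rw [hs]
  calc ‖∑ i : Fin k → Fin n, (∏ j, v j (i j)) * M (fun j => Pi.single (i j) (1 : ℝ))‖
      ≤ ∑ _i : Fin k → Fin n, (∏ j, ‖v j‖) * B := by
        refine norm_sum_le_of_le _ fun i _ => ?_
        rw [norm_mul, norm_prod]
        gcongr with j
        · exact norm_le_pi_norm (v j) (i j)
        · exact hB i
    _ = (n : ℝ) ^ k * B * ∏ j, ‖v j‖ := by
        rw [Finset.sum_const, Finset.card_univ, Fintype.card_fun, Fintype.card_fin,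
          Fintype.card_fin, nsmul_eq_mul]
        push_cast; ring

theorem norm_iteratedFDeriv_sub_le {n k : ℕ} {F G : RN n → ℝ} (hF : ContDiff ℝ k F)
    (hG : ContDiff ℝ k G) (x y : RN n) {B : ℝ} (hB0 : 0 ≤ B)
    (hB : ∀ α ∈ multiIndexEq n k, |partialD α F x - partialD α G y| ≤ B) :
    ‖iteratedFDeriv ℝ k F x - iteratedFDeriv ℝ k G y‖ ≤ (n : ℝ) ^ k * B := by
  refine norm_multilinear_le_of_single _ (fun i => ?_) hB0
  rw [sub_apply, iteratedFDeriv_apply_single hF,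
    iteratedFDeriv_apply_single hG]
  exact hB _ (mem_multiIndexEq.2 (sum_tupleCount i))

/-! ### Derivatives and Taylor expansions of polynomials -/

theorem hasFDerivAt_polyFun {n : ℕ} (P : MvPolynomial (Fin n) ℝ) (x : RN n) :
    HasFDerivAt (polyFun P) (∑ i, polyFun (MvPolynomial.pderiv i P) x •
      (ContinuousLinearMap.proj i : RN n →L[ℝ] ℝ)) x := by
  classical
  induction P using MvPolynomial.induction_on with
  | C a =>
    have : polyFun (MvPolynomial.C a : MvPolynomial (Fin n) ℝ) = fun _ => a := by
      funext y; simp [polyFun]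
    rw [this]
    simpa [polyFun] using hasFDerivAt_const a x
  | add P Q hP hQ =>
    have : polyFun (P + Q) = fun y => polyFun P y + polyFun Q y := by
      funext y; simp [polyFun]
    rw [this]
    convert! hP.add hQ using 1
    rw [← Finset.sum_add_distrib]
    refine Finset.sum_congr rfl fun i _ => ?_
    rw [← add_smul]
    simp [polyFun]
  | mul_X P j hP =>
    have : polyFun (P * MvPolynomial.X j) = fun y => polyFun P y * y j := by
      funext y; simp [polyFun]
    rw [this]
    convert! hP.mul (hasFDerivAt_apply (𝕜 := ℝ) j x) using 1
    ext v
    simp only [polyFun, Derivation.leibniz, MvPolynomial.pderiv_X, smul_eq_mul, map_add, map_mul,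
      MvPolynomial.eval_X, FunLike.coe_sum, Finset.sum_apply, add_apply,
      smul_apply, ContinuousLinearMap.proj_apply, add_mul, Finset.sum_add_distrib, Finset.mul_sum]
    congr 1
    · rw [Finset.sum_eq_single j]
      · simp
      · intro i _ hi; simp [hi.symm]
      · simp
    · exact Finset.sum_congr rfl fun i _ => mul_assoc _ _ _

theorem contDiff_polyFun {n : ℕ} {N : WithTop ℕ∞} (P : MvPolynomial (Fin n) ℝ) :
    ContDiff ℝ N (polyFun P) := by
  have h : AnalyticOnNhd ℝ (polyFun P) Set.univ := AnalyticOnNhd.eval_mvPolynomial P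
  exact (AnalyticOnNhd.contDiff h).of_le le_top

theorem fderiv_polyFun_single {n : ℕ} (P : MvPolynomial (Fin n) ℝ) (l : Fin n) (x : RN n) :
    fderiv ℝ (polyFun P) x (Pi.single l 1) = polyFun (MvPolynomial.pderiv l P) x := by
  classical
  rw [(hasFDerivAt_polyFun P x).fderiv]
  simp [Pi.single_apply]

/-- The iterated partial derivative of a polynomial along the directions `i (k - 1), …, i 0`. -/
noncomputable def iterPderiv {n : ℕ} : (k : ℕ) → (Fin k → Fin n) → MvPolynomial (Fin n) ℝ →
    MvPolynomial (Fin n) ℝ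
  | 0, _, P => P
  | k + 1, i, P => iterPderiv k (Fin.init i) (MvPolynomial.pderiv (i (Fin.last k)) P)

theorem iteratedFDeriv_polyFun_single {n : ℕ} (k : ℕ) (i : Fin k → Fin n)
    (P : MvPolynomial (Fin n) ℝ) (x : RN n) :
    iteratedFDeriv ℝ k (polyFun P) x (fun j => Pi.single (i j) (1 : ℝ)) =
      polyFun (iterPderiv k i P) x := by
  induction k generalizing P with
  | zero => simp [iterPderiv]
  | succ k ih =>
    rw [iteratedFDeriv_succ_apply_last (contDiff_polyFun P)]
    simp only [fderiv_polyFun_single]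
    exact ih (Fin.init i) _

theorem prod_factorial_add_single {n : ℕ} (γ : Fin n →₀ ℕ) (l : Fin n) :
    ∏ t, ((γ + Finsupp.single l 1 : Fin n →₀ ℕ) t).factorial =
      (γ l + 1) * ∏ t, (γ t).factorial := by
  classical
  rw [← Finset.mul_prod_erase _ _ (Finset.mem_univ l),
    ← Finset.mul_prod_erase Finset.univ (fun t => (γ t).factorial) (Finset.mem_univ l),
    ← mul_assoc]
  congr 1
  · simp [Nat.factorial_succ]
  · refine Finset.prod_congr rfl fun t ht => ?_
    simp [(Finset.ne_of_mem_erase ht).symm]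

/-- Up to factorials, iterated partial derivatives shift the coefficients of a polynomial. -/
theorem coeff_iterPderiv {n : ℕ} (k : ℕ) (i : Fin k → Fin n) (P : MvPolynomial (Fin n) ℝ)
    (β : Fin n →₀ ℕ) :
    MvPolynomial.coeff β (iterPderiv k i P) * ((∏ t, (β t).factorial : ℕ) : ℝ) =
      MvPolynomial.coeff (β + tupleCount i) P *
        ((∏ t, ((β + tupleCount i) t).factorial : ℕ) : ℝ) := by
  induction k generalizing P with
  | zero => simp [iterPderiv, tupleCount]
  | succ k ih =>
    rw [iterPderiv, ih, MvPolynomial.coeff_pderiv, tupleCount_succ, ← add_assoc,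
      prod_factorial_add_single]
    push_cast
    ring

theorem iterPderiv_eq_zero {n m k : ℕ} {P : MvPolynomial (Fin n) ℝ} (hP : P.totalDegree ≤ m)
    (hk : m < k) (i : Fin k → Fin n) : iterPderiv k i P = 0 := by
  ext β
  have h := coeff_iterPderiv k i P β
  rw [MvPolynomial.coeff_eq_zero_of_totalDegree_lt (d := β + tupleCount i), zero_mul,
    mul_eq_zero] at h
  · rcases h with h | h
    · simpa using h
    · exact absurd h (by exact_mod_cast (Finset.prod_pos fun t _ => Nat.factorial_pos _).ne')
  · refine lt_of_le_of_lt hP (hk.trans_le ?_)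
    have : ∑ l, (β + tupleCount i) l = (∑ l, β l) + k := by
      simp only [Finsupp.add_apply, Finset.sum_add_distrib, sum_tupleCount]
    have h2 : (∑ l ∈ (β + tupleCount i).support, (β + tupleCount i) l) =
        ∑ l, (β + tupleCount i) l := by
      apply Finset.sum_subset (Finset.subset_univ _)
      intro l _ hl
      simpa using hl
    rw [h2, this]
    omega

theorem iteratedFDeriv_polyFun_eq_zero {n m k : ℕ} {P : MvPolynomial (Fin n) ℝ}
    (hP : P.totalDegree ≤ m) (hk : m < k) (x : RN n) : iteratedFDeriv ℝ k (polyFun P) x = 0 := by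
  rw [← norm_le_zero_iff]
  refine (norm_multilinear_le_of_single _ (B := 0) (fun i => ?_) le_rfl).trans (by simp)
  rw [iteratedFDeriv_polyFun_single, iterPderiv_eq_zero hP hk]
  simp [polyFun]

/-- The polynomial `y ↦ P (y + x)`. -/
noncomputable def translatePoly {n : ℕ} (x : RN n) :
    MvPolynomial (Fin n) ℝ →ₐ[ℝ] MvPolynomial (Fin n) ℝ :=
  MvPolynomial.aeval fun i => MvPolynomial.X i + MvPolynomial.C (x i)

theorem translatePoly_injective {n : ℕ} (x : RN n) : Function.Injective (translatePoly x) := by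
  let g : MvPolynomial (Fin n) ℝ →ₐ[ℝ] MvPolynomial (Fin n) ℝ :=
    MvPolynomial.aeval fun i => MvPolynomial.X i - MvPolynomial.C (x i)
  have h : g.comp (translatePoly x) = AlgHom.id ℝ _ := by
    ext i
    simp [translatePoly, g]
  exact Function.LeftInverse.injective (g := g) fun P => DFunLike.congr_fun h P

theorem polyFun_translatePoly {n : ℕ} (x : RN n) (P : MvPolynomial (Fin n) ℝ) :
    polyFun (translatePoly x P) = fun y => polyFun P (y + x) := by
  funext y
  induction P using MvPolynomial.induction_on with
  | C a => simp [polyFun, translatePoly]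
  | add P Q hP hQ => simp_all [polyFun]
  | mul_X P j hP => simp_all [polyFun, translatePoly]

/-- The coefficients of the expansion of `P` about `x` are the derivatives of `P` at `x`. -/
theorem coeff_translatePoly {n : ℕ} (x : RN n) (P : MvPolynomial (Fin n) ℝ) (β : Fin n →₀ ℕ) :
    MvPolynomial.coeff β (translatePoly x P) * ((∏ t, (β t).factorial : ℕ) : ℝ) =
      partialD β (polyFun P) x := by
  have h := coeff_iterPderiv _ (fun j : Fin (∑ i, β i) => (finSigmaFinEquiv.symm j).1)
    (translatePoly x P) 0
  have hβ : tupleCount (fun j : Fin (∑ i, β i) => (finSigmaFinEquiv.symm j).1) = β :=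
    Finsupp.ext fun l => tupleCount_finSigma _ l
  rw [hβ, zero_add] at h
  rw [← h, partialD]
  have e : ∀ Q : MvPolynomial (Fin n) ℝ, MvPolynomial.coeff 0 Q = polyFun Q 0 := by
    intro Q
    rw [← MvPolynomial.constantCoeff_eq, polyFun, MvPolynomial.eval_zero]
  rw [e, ← iteratedFDeriv_polyFun_single, polyFun_translatePoly, iteratedFDeriv_comp_add_right]
  simp

theorem coeff_translatePoly_taylorPoly {n m : ℕ} (F : RN n → ℝ) (x : RN n) (β : Fin n →₀ ℕ) :
    MvPolynomial.coeff β (translatePoly x (taylorPoly m F x)) =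
      if (β : Fin n → ℕ) ∈ multiIndexLE n m then
        partialD β F x / ((∏ t, (β t).factorial : ℕ) : ℝ) else 0 := by
  classical
  have h : translatePoly x (taylorPoly m F x) = ∑ α ∈ multiIndexLE n m,
      MvPolynomial.monomial (Finsupp.equivFunOnFinite.symm α)
        (partialD α F x / ((∏ i, (α i).factorial : ℕ) : ℝ)) := by
    rw [taylorPoly, map_sum]
    refine Finset.sum_congr rfl fun α _ => ?_
    rw [MvPolynomial.monomial_eq, map_mul, map_prod]
    congr 1
    · exact (translatePoly x).commutes _
    · rw [Finsupp.prod_fintype _ _ (by simp)]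
      refine Finset.prod_congr rfl fun i _ => ?_
      simp [translatePoly]
  rw [h, MvPolynomial.coeff_sum]
  simp only [MvPolynomial.coeff_monomial]
  have h2 : ∀ α : Fin n → ℕ, Finsupp.equivFunOnFinite.symm α = β ↔ α = β := by
    intro α
    rw [Equiv.symm_apply_eq]; rfl
  simp only [h2, Finset.sum_ite_eq']

theorem partialD_eq_of_taylorPoly_eq {n m : ℕ} {F : RN n → ℝ} {x : RN n}
    {P : MvPolynomial (Fin n) ℝ} (h : taylorPoly m F x = P) {α : Fin n → ℕ}
    (hα : ∑ i, α i ≤ m) : partialD α F x = partialD α (polyFun P) x := by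
  have h1 := coeff_translatePoly x P (Finsupp.equivFunOnFinite.symm α)
  have h2 : ((Finsupp.equivFunOnFinite.symm α : Fin n →₀ ℕ) : Fin n → ℕ) = α := rfl
  rw [← h, coeff_translatePoly_taylorPoly, h, h2, if_pos (mem_multiIndexLE.2 hα),
    div_mul_cancel₀ _
      (by exact_mod_cast (Finset.prod_pos fun t _ => Nat.factorial_pos _).ne')] at h1
  exact h1

theorem taylorPoly_eq_of_partialD_eq {n m : ℕ} {F : RN n → ℝ} {x : RN n}
    {P : MvPolynomial (Fin n) ℝ} (hP : P.totalDegree ≤ m)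
    (h : ∀ α : Fin n → ℕ, ∑ i, α i ≤ m → partialD α F x = partialD α (polyFun P) x) :
    taylorPoly m F x = P := by
  apply translatePoly_injective x
  ext β
  rw [coeff_translatePoly_taylorPoly]
  have hpos : ((∏ t, (β t).factorial : ℕ) : ℝ) ≠ 0 := by
    exact_mod_cast (Finset.prod_pos fun t _ => Nat.factorial_pos _).ne'
  have h1 := coeff_translatePoly x P β
  split_ifs with hβ
  · rw [h β (mem_multiIndexLE.1 hβ), ← h1, mul_div_cancel_right₀ _ hpos]
  · rw [mem_multiIndexLE, not_le] at hβ
    rw [partialD, iteratedFDeriv_polyFun_eq_zero hP hβ] at h1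
    exact ((mul_eq_zero.1 h1).resolve_right hpos).symm

/-! ### Derivative bounds for products and inverses -/

theorem exists_isOpen_contDiffOn {E : Type*} [NormedAddCommGroup E] [NormedSpace ℝ E] {k : ℕ}
    {f : E → ℝ} {x : E} (hf : ContDiffAt ℝ k f x) :
    ∃ u, IsOpen u ∧ x ∈ u ∧ ContDiffOn ℝ k f u := by
  obtain ⟨u, hu, hfu⟩ := hf.contDiffOn le_rfl (by simp)
  obtain ⟨v, hvu, hv, hxv⟩ := mem_nhds_iff.1 hu
  exact ⟨v, hv, hxv, hfu.mono hvu⟩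

theorem norm_iteratedFDeriv_mul_le_pow {E : Type*} [NormedAddCommGroup E] [NormedSpace ℝ E]
    {k : ℕ} {f g : E → ℝ} {x : E} (hf : ContDiffAt ℝ k f x) (hg : ContDiffAt ℝ k g x)
    {A B t : ℝ} (hA : ∀ j ≤ k, ‖iteratedFDeriv ℝ j f x‖ ≤ A * t ^ j)
    (hB : ∀ j ≤ k, ‖iteratedFDeriv ℝ j g x‖ ≤ B * t ^ j) :
    ‖iteratedFDeriv ℝ k (fun y => f y * g y) x‖ ≤ 2 ^ k * (A * B) * t ^ k := by
  obtain ⟨u, hu, hxu, hfu⟩ := exists_isOpen_contDiffOn hf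
  obtain ⟨v, hv, hxv, hgv⟩ := exists_isOpen_contDiffOn hg
  have ho := hu.inter hv
  have hx : x ∈ u ∩ v := ⟨hxu, hxv⟩
  have h := norm_iteratedFDerivWithin_mul_le (hfu.mono Set.inter_subset_left)
    (hgv.mono Set.inter_subset_right) ho.uniqueDiffOn hx (n := k) le_rfl
  simp only [iteratedFDerivWithin_of_isOpen _ ho hx] at h
  refine h.trans ?_
  have h2 : ∀ i ∈ Finset.range (k + 1), (k.choose i : ℝ) * ‖iteratedFDeriv ℝ i f x‖ *
      ‖iteratedFDeriv ℝ (k - i) g x‖ ≤ (k.choose i : ℝ) * (A * B * t ^ k) := by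
    intro i hi
    have hik : i ≤ k := Nat.lt_succ_iff.1 (Finset.mem_range.1 hi)
    rw [mul_assoc]
    refine mul_le_mul_of_nonneg_left ?_ (Nat.cast_nonneg _)
    calc ‖iteratedFDeriv ℝ i f x‖ * ‖iteratedFDeriv ℝ (k - i) g x‖
        ≤ (A * t ^ i) * (B * t ^ (k - i)) :=
          mul_le_mul (hA i hik) (hB _ (Nat.sub_le _ _)) (norm_nonneg _)
            ((norm_nonneg _).trans (hA i hik))
      _ = A * B * t ^ k := by rw [← Nat.add_sub_cancel' hik, pow_add]; simp; ring
  refine (Finset.sum_le_sum h2).trans (le_of_eq ?_)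
  rw [← Finset.sum_mul]
  have := Nat.sum_range_choose k
  have h3 : (∑ i ∈ Finset.range (k + 1), (k.choose i : ℝ)) = 2 ^ k := by exact_mod_cast this
  rw [h3]; ring

theorem norm_iteratedFDeriv_inv_le {k : ℕ} {y : ℝ} (hy : 1 ≤ y) :
    ‖iteratedFDeriv ℝ k (Inv.inv : ℝ → ℝ) y‖ ≤ k.factorial := by
  rw [norm_iteratedFDeriv_eq_norm_iteratedDeriv, iteratedDeriv_eq_iterate, iter_deriv_inv]
  have h : (-1 - (k : ℤ)) ≤ 0 := by omega
  rw [norm_mul, norm_mul, norm_pow, norm_neg, norm_one, one_pow, one_mul,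
    Real.norm_of_nonneg (by positivity : (0 : ℝ) ≤ k.factorial),
    Real.norm_of_nonneg (by positivity : (0 : ℝ) ≤ y ^ (-1 - (k : ℤ)))]
  exact mul_le_of_le_one_right (by positivity) (zpow_le_one_of_nonpos₀ hy h)

theorem norm_iteratedFDeriv_fun_inv_le {E : Type*} [NormedAddCommGroup E] [NormedSpace ℝ E]
    {k : ℕ} {f : E → ℝ} {x : E} (hf : ContDiffAt ℝ k f x) (hx : 1 ≤ f x) {D : ℝ}
    (hD : ∀ j, 1 ≤ j → j ≤ k → ‖iteratedFDeriv ℝ j f x‖ ≤ D ^ j) :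
    ‖iteratedFDeriv ℝ k (fun y => (f y)⁻¹) x‖ ≤ k.factorial * k.factorial * D ^ k := by
  obtain ⟨u, hu, hxu, hfu⟩ := exists_isOpen_contDiffOn hf
  have ho : IsOpen (u ∩ f ⁻¹' {0}ᶜ) :=
    hfu.continuousOn.isOpen_inter_preimage hu isOpen_compl_singleton
  have hxo : x ∈ u ∩ f ⁻¹' {0}ᶜ := ⟨hxu, by simp; linarith⟩
  have ht : IsOpen ({0}ᶜ : Set ℝ) := isOpen_compl_singleton
  have h := norm_iteratedFDerivWithin_comp_le (n := k) (contDiffOn_inv ℝ (n := k))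
    (hfu.mono Set.inter_subset_left) le_rfl ht.uniqueDiffOn ho.uniqueDiffOn
    (fun y hy => hy.2) hxo (C := k.factorial) (D := D) (fun i hi => by
      rw [iteratedFDerivWithin_of_isOpen _ ht hxo.2]
      refine (norm_iteratedFDeriv_inv_le hx).trans ?_
      exact_mod_cast Nat.factorial_le hi)
    (fun i h1 hi => by
      rw [iteratedFDerivWithin_of_isOpen _ ho hxo]
      exact hD i h1 hi)
  rwa [iteratedFDerivWithin_of_isOpen _ ho hxo] at h

theorem norm_iteratedFDeriv_comp_smul_sub_le {E : Type*} [NormedAddCommGroup E] [NormedSpace ℝ E]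
    {k : ℕ} {f : E → ℝ} (hf : ContDiff ℝ k f) {t B : ℝ} (ht : 0 ≤ t)
    (hB : ∀ x, ‖iteratedFDeriv ℝ k f x‖ ≤ B) (w x : E) :
    ‖iteratedFDeriv ℝ k (fun y => f (t • y - w)) x‖ ≤ B * t ^ k := by
  have h := ContinuousLinearMap.iteratedFDeriv_comp_right (t • ContinuousLinearMap.id ℝ E)
    (f := fun y => f (y - w)) (n := k) (hf.comp (contDiff_id.sub contDiff_const)) x le_rfl
  have e : (fun y => f (y - w)) ∘ ⇑(t • ContinuousLinearMap.id ℝ E) = fun y => f (t • y - w) := by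
    funext y; simp
  rw [e] at h
  rw [h]
  refine (ContinuousMultilinearMap.norm_compContinuousLinearMap_le _ _).trans ?_
  rw [iteratedFDeriv_comp_sub', Finset.prod_const, Finset.card_univ, Fintype.card_fin]
  have h1 : ‖t • ContinuousLinearMap.id ℝ E‖ ≤ t := by
    rw [norm_smul, Real.norm_of_nonneg ht]
    exact mul_le_of_le_one_right ht ContinuousLinearMap.norm_id_le
  exact mul_le_mul (hB _) (by gcongr) (by positivity) ((norm_nonneg _).trans (hB x))

/-! ### The Whitney partition of unity -/

/-- The centre `2^k j` of the grid cube of side `2^k` with index `(k, j)`. -/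
noncomputable def gridPoint {n : ℕ} (i : ℤ × (Fin n → ℤ)) : RN n :=
  (2 : ℝ) ^ i.1 • fun l => (i.2 l : ℝ)

/-- The grid cubes of side comparable to their distance to `E`. -/
def IsWhitneyIndex {n : ℕ} (E : Set (RN n)) (i : ℤ × (Fin n → ℤ)) : Prop :=
  15 * (2 : ℝ) ^ i.1 ≤ Metric.infDist (gridPoint i) E ∧
    Metric.infDist (gridPoint i) E ≤ 33 * (2 : ℝ) ^ i.1

theorem infDist_sub_le {n : ℕ} (E : Set (RN n)) (x y : RN n) :
    Metric.infDist x E ≤ Metric.infDist y E + ‖x - y‖ := by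
  rw [← dist_eq_norm]; exact Metric.infDist_le_infDist_add_dist

/-- Every point off `E` lies in the middle half of a Whitney cube. -/
theorem exists_isWhitneyIndex {n : ℕ} {E : Set (RN n)} {y : RN n} (hy : 0 < Metric.infDist y E) :
    ∃ i : ℤ × (Fin n → ℤ), IsWhitneyIndex E i ∧
      ‖((2 : ℝ) ^ i.1)⁻¹ • y - fun l => (i.2 l : ℝ)‖ ≤ 1 / 2 := by
  obtain ⟨k, hk1, hk2⟩ := exists_mem_Ico_zpow hy (one_lt_two : (1 : ℝ) < 2)
  -- The side is chosen so that `16 * 2 ^ (k - 4) ≤ dist(y, E) < 32 * 2 ^ (k - 4)`.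
  set s : ℝ := 2 ^ (k - 4) with hs
  have hs0 : 0 < s := by positivity
  have e1 : (2 : ℝ) ^ k = 16 * s := by
    rw [hs, zpow_sub₀ (by norm_num)]; norm_num; field_simp
  have e2 : (2 : ℝ) ^ (k + 1) = 32 * s := by
    rw [zpow_add₀ (by norm_num), e1]; ring
  rw [e1] at hk1
  rw [e2] at hk2
  let j : Fin n → ℤ := fun l => round (s⁻¹ * y l)
  have hb : ‖s⁻¹ • y - fun l => (j l : ℝ)‖ ≤ 1 / 2 := by
    rw [pi_norm_le_iff_of_nonneg (by norm_num)]
    intro l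
    exact abs_sub_round _
  have hd : ‖y - gridPoint (k - 4, j)‖ ≤ s / 2 := by
    have : y - gridPoint (k - 4, j) = s • (s⁻¹ • y - fun l => (j l : ℝ)) := by
      rw [smul_sub, smul_inv_smul₀ hs0.ne']; rfl
    rw [this, norm_smul, Real.norm_of_nonneg hs0.le]
    nlinarith
  have h1 := infDist_sub_le E y (gridPoint (k - 4, j))
  have h2 := infDist_sub_le E (gridPoint (k - 4, j)) y
  rw [norm_sub_rev] at h2
  exact ⟨(k - 4, j), ⟨by change 15 * s ≤ _; linarith, by change _ ≤ 33 * s; linarith⟩, hb⟩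

/-- The indices of the Whitney cubes close to `x`. -/
def nearIndices {n : ℕ} (E : Set (RN n)) (x : RN n) :
    Set {i : ℤ × (Fin n → ℤ) // IsWhitneyIndex E i} :=
  {i | ‖gridPoint i.1 - x‖ ≤ (2 : ℝ) ^ i.1.1 + Metric.infDist x E / 4}

theorem nearIndices_bounds {n : ℕ} {E : Set (RN n)} {x : RN n}
    {i : {i : ℤ × (Fin n → ℤ) // IsWhitneyIndex E i}} (hi : i ∈ nearIndices E x) :
    11 * (2 : ℝ) ^ i.1.1 ≤ Metric.infDist x E ∧ Metric.infDist x E ≤ 46 * (2 : ℝ) ^ i.1.1 := by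
  have hi' : ‖gridPoint i.1 - x‖ ≤ (2 : ℝ) ^ i.1.1 + Metric.infDist x E / 4 := hi
  have h1 := infDist_sub_le E x (gridPoint i.1)
  have h2 := infDist_sub_le E (gridPoint i.1) x
  rw [norm_sub_rev] at h1
  obtain ⟨h3, h4⟩ := i.2
  have : 0 < (2 : ℝ) ^ i.1.1 := by positivity
  constructor <;> linarith

/-- The number of Whitney cubes close to a point is bounded: up to translation, their scales and
positions lie in a fixed finite set of integer vectors. -/
theorem exists_nearIndices_finset {n : ℕ} {E : Set (RN n)} {x : RN n}
    (hx : 0 < Metric.infDist x E) :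
    ∃ J : Finset {i : ℤ × (Fin n → ℤ) // IsWhitneyIndex E i},
      (∀ i, i ∈ J ↔ i ∈ nearIndices E x) ∧
      J.card ≤ (Finset.Icc (-6 : ℤ) 0 ×ˢ
        Fintype.piFinset fun _ : Fin n => Finset.Icc (-14 : ℤ) 14).card := by
  classical
  obtain ⟨k, hk1, hk2⟩ := exists_mem_Ico_zpow hx (one_lt_two : (1 : ℝ) < 2)
  let f : {i : ℤ × (Fin n → ℤ) // IsWhitneyIndex E i} → ℤ × (Fin n → ℤ) := fun i =>
    (i.1.1 - k, fun l => i.1.2 l - round (((2 : ℝ) ^ i.1.1)⁻¹ * x l))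
  have hf : Function.Injective f := by
    rintro ⟨⟨k1, j1⟩, h1⟩ ⟨⟨k2, j2⟩, h2⟩ h
    simp only [f, Prod.mk.injEq] at h
    obtain ⟨ha, hb⟩ := h
    obtain rfl : k1 = k2 := by omega
    have : j1 = j2 := by
      funext l
      have := congrFun hb l
      simpa using this
    subst this
    rfl
  have hmap : Set.MapsTo f (nearIndices E x) (Finset.Icc (-6 : ℤ) 0 ×ˢ
      Fintype.piFinset fun _ : Fin n => Finset.Icc (-14 : ℤ) 14 : Finset (ℤ × (Fin n → ℤ))) := by
    intro i hi
    obtain ⟨hb1, hb2⟩ := nearIndices_bounds hi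
    set s : ℝ := 2 ^ i.1.1 with hs
    have hs0 : 0 < s := by positivity
    simp only [f, Finset.coe_product, Set.mem_prod, Finset.mem_coe, Finset.mem_Icc,
      Fintype.mem_piFinset]
    refine ⟨⟨?_, ?_⟩, fun l => ?_⟩
    · have h1 : (2 : ℝ) ^ k < 2 ^ (i.1.1 + 6) := by
        rw [zpow_add₀ (by norm_num), ← hs]; norm_num; linarith
      have := (zpow_lt_zpow_iff_right₀ (one_lt_two : (1 : ℝ) < 2)).1 h1
      omega
    · have h1 : (2 : ℝ) ^ i.1.1 < 2 ^ (k + 1) := by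
        rw [← hs]; linarith
      have := (zpow_lt_zpow_iff_right₀ (one_lt_two : (1 : ℝ) < 2)).1 h1
      omega
    · have hi' : ‖gridPoint i.1 - x‖ ≤ s + Metric.infDist x E / 4 := hi
      have h1 : |s * (i.1.2 l : ℝ) - x l| ≤ 13 * s :=
        (norm_le_pi_norm (gridPoint i.1 - x) l).trans (by linarith)
      have h2 : |(i.1.2 l : ℝ) - s⁻¹ * x l| ≤ 13 := by
        have : (i.1.2 l : ℝ) - s⁻¹ * x l = s⁻¹ * (s * (i.1.2 l : ℝ) - x l) := by
          field_simp
        rw [this, abs_mul, abs_of_pos (by positivity : 0 < s⁻¹), inv_mul_le_iff₀ hs0]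
        linarith
      have h3 := abs_sub_round (s⁻¹ * x l)
      rw [abs_le] at h2 h3
      have h4 : (-14 : ℝ) ≤ ((i.1.2 l - round (s⁻¹ * x l) : ℤ) : ℝ) := by
        push_cast; linarith [h2.1, h3.1]
      have h5 : ((i.1.2 l - round (s⁻¹ * x l) : ℤ) : ℝ) ≤ 14 := by
        push_cast; linarith [h2.2, h3.2]
      exact ⟨by exact_mod_cast h4, by exact_mod_cast h5⟩
  have hfin : (nearIndices E x).Finite := Set.Finite.of_injOn hmap hf.injOn (Finset.finite_toSet _)
  refine ⟨hfin.toFinset, fun i => hfin.mem_toFinset, ?_⟩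
  refine Finset.card_le_card_of_injOn f (fun i hi => hmap ?_) hf.injOn
  simpa using hi

/-- A smooth bump function, equal to `1` on the cube of half-side `1/2` and supported in the cube
of half-side `1` about the origin. -/
noncomputable def unitBump (n : ℕ) : ContDiffBump (0 : RN n) where
  rIn := 1 / 2
  rOut := 1
  rIn_pos := by norm_num
  rIn_lt_rOut := by norm_num

theorem contDiff_unitBump (n M : ℕ) : ContDiff ℝ M (unitBump n) :=
  (unitBump n).contDiff (n := (M : ℕ∞))

theorem exists_unitBump_bound (n M : ℕ) :
    ∃ B : ℝ, 1 ≤ B ∧ ∀ k ≤ M, ∀ x, ‖iteratedFDeriv ℝ k (unitBump n) x‖ ≤ B := by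
  have h : ∀ k : ℕ, ∃ C, ∀ x, ‖iteratedFDeriv ℝ k (unitBump n) x‖ ≤ C := fun k =>
    ((unitBump n).hasCompactSupport.iteratedFDeriv k).exists_bound_of_continuous
      ((contDiff_unitBump n k).continuous_iteratedFDeriv le_rfl)
  choose C hC using h
  refine ⟨1 + ∑ k ∈ Finset.range (M + 1), |C k|, ?_, fun k hk x => (hC k x).trans ?_⟩
  · have : 0 ≤ ∑ k ∈ Finset.range (M + 1), |C k| := Finset.sum_nonneg fun _ _ => abs_nonneg _
    linarith
  · have := Finset.single_le_sum (f := fun k => |C k|) (s := Finset.range (M + 1))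
      (fun _ _ => abs_nonneg _) (Finset.mem_range.2 (Nat.lt_succ_of_le hk))
    have h2 := le_abs_self (C k)
    linarith

/-- The bump function of the grid cube with index `i`. -/
noncomputable def gridBump {n : ℕ} (i : ℤ × (Fin n → ℤ)) (x : RN n) : ℝ :=
  unitBump n (((2 : ℝ) ^ i.1)⁻¹ • x - fun l => (i.2 l : ℝ))

theorem contDiff_gridBump {n : ℕ} (M : ℕ) (i : ℤ × (Fin n → ℤ)) : ContDiff ℝ M (gridBump i) :=
  (contDiff_unitBump n M).comp ((contDiff_id.const_smul _).sub contDiff_const)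

theorem gridBump_eq_zero {n : ℕ} {i : ℤ × (Fin n → ℤ)} {x : RN n}
    (h : (2 : ℝ) ^ i.1 ≤ ‖gridPoint i - x‖) : gridBump i x = 0 := by
  apply (unitBump n).zero_of_le_dist
  have hs0 : 0 < (2 : ℝ) ^ i.1 := by positivity
  have : gridPoint i - x =
      (2 : ℝ) ^ i.1 • ((fun l => (i.2 l : ℝ)) - ((2 : ℝ) ^ i.1)⁻¹ • x) := by
    rw [smul_sub, smul_inv_smul₀ hs0.ne']; rfl
  rw [this, norm_smul, Real.norm_of_nonneg hs0.le, norm_sub_rev] at h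
  rw [dist_zero_right]
  exact le_of_mul_le_mul_left ((mul_one _).trans_le h) hs0

/-- A smooth partition of unity off `E` with boundedly many terms at each point `x`, whose
`k`-th derivatives at `x` are bounded by multiples of `dist(x,E)^{-k}`; each function is labelled
by a point of `E` at distance at most a multiple of `dist(x,E)` from `x`. -/
theorem exists_whitney_partition (n M : ℕ) : ∃ N : ℕ, ∃ C : ℝ, 1 ≤ C ∧
    ∀ E : Set (RN n), IsClosed E → E.Nonempty →
      ∃ (ι : Type) (φ : ι → RN n → ℝ) (a : ι → RN n), (∀ i, a i ∈ E) ∧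
        ∀ x ∉ E, ∃ J : Finset ι, J.card ≤ N ∧
          (∀ᶠ y in nhds x, (∀ i ∉ J, φ i y = 0) ∧ ∑ i ∈ J, φ i y = 1) ∧
          ∀ i ∈ J, ContDiffAt ℝ M (φ i) x ∧ ‖x - a i‖ ≤ C * Metric.infDist x E ∧
            ∀ k ≤ M, ‖iteratedFDeriv ℝ k (φ i) x‖ ≤ C * (Metric.infDist x E)⁻¹ ^ k := by
  classical
  obtain ⟨B, hB1, hB⟩ := exists_unitBump_bound n M
  set N : ℕ := (Finset.Icc (-6 : ℤ) 0 ×ˢ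
    Fintype.piFinset fun _ : Fin n => Finset.Icc (-14 : ℤ) 14).card + 1 with hN
  -- The extra `1` in `N` ensures `1 ≤ N * B`. The factors of `K` bound the Leibniz coefficients, a
  -- bump function, the inverse of the sum of the bump functions, and the ratio of the distance to
  -- `E` to the side of a nearby Whitney cube, which is at most `46`.
  set K : ℝ := 2 ^ M * (B * (M.factorial * M.factorial * (N * B) ^ M)) * 46 ^ M with hK
  have hNB : 1 ≤ (N : ℝ) * B := by
    have : (1 : ℝ) ≤ N := by exact_mod_cast (by omega : 1 ≤ N)
    nlinarith
  have hK0 : 0 ≤ K := by positivity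
  refine ⟨N, 4 + K, by linarith, fun E hE hne => ?_⟩
  choose nearest hnE hnd using fun x => hE.exists_infDist_eq_dist hne x
  let ι := {i : ℤ × (Fin n → ℤ) // IsWhitneyIndex E i}
  let Ψ : RN n → ℝ := fun y => ∑ᶠ i : ι, gridBump i.1 y
  refine ⟨ι, fun i y => gridBump i.1 y * (Ψ y)⁻¹, fun i => nearest (gridPoint i.1),
    fun i => hnE _, fun x hx => ?_⟩
  have hD : 0 < Metric.infDist x E := (hE.notMem_iff_infDist_pos hne).1 hx
  set D := Metric.infDist x E with hDdef
  obtain ⟨J, hJ, hJc⟩ := exists_nearIndices_finset hD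
  have hnear : ∀ y ∈ Metric.ball x (D / 4), (∀ i ∉ J, gridBump i.1 y = 0) ∧
      Ψ y = ∑ i ∈ J, gridBump i.1 y ∧ 1 ≤ ∑ i ∈ J, gridBump i.1 y := by
    intro y hy
    rw [mem_ball_iff_norm] at hy
    have h0 : ∀ i ∉ J, gridBump i.1 y = 0 := by
      intro i hi
      rw [hJ] at hi
      have hi' : (2 : ℝ) ^ i.1.1 + D / 4 < ‖gridPoint i.1 - x‖ := not_le.1 hi
      apply gridBump_eq_zero
      have := norm_add_le (gridPoint i.1 - y) (y - x)
      rw [sub_add_sub_cancel] at this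
      linarith
    refine ⟨h0, finsum_eq_sum_of_support_subset _ fun i hi => ?_, ?_⟩
    · by_contra h
      exact hi (h0 i h)
    · have hy0 : 0 < Metric.infDist y E := by
        have := infDist_sub_le E x y
        rw [norm_sub_rev] at this
        linarith
      obtain ⟨i, hi, hi2⟩ := exists_isWhitneyIndex hy0
      have h1 : gridBump i y = 1 := by
        apply (unitBump n).one_of_mem_closedBall
        rw [mem_closedBall_zero_iff]
        exact hi2
      have hiJ : (⟨i, hi⟩ : ι) ∈ J := by
        by_contra h
        have := h0 _ h
        simp only at this
        linarith
      calc (1 : ℝ) = gridBump (⟨i, hi⟩ : ι).1 y := h1.symm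
        _ ≤ _ := Finset.single_le_sum (f := fun i : ι => gridBump i.1 y)
          (fun _ _ => (unitBump n).nonneg) hiJ
  have hball : Metric.ball x (D / 4) ∈ nhds x := Metric.ball_mem_nhds x (by positivity)
  refine ⟨J, hJc.trans (Nat.le_succ _), ?_, fun i hi => ?_⟩
  · filter_upwards [hball] with y hy
    obtain ⟨h0, h1, h2⟩ := hnear y hy
    refine ⟨fun i hi => by rw [h0 i hi, zero_mul], ?_⟩
    rw [← Finset.sum_mul, h1, mul_inv_cancel₀ (by linarith)]
  have hxb := hnear x (Metric.mem_ball_self (by positivity))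
  obtain ⟨hb1, hb2⟩ := nearIndices_bounds ((hJ i).1 hi)
  have hev : (fun y => gridBump i.1 y * (Ψ y)⁻¹) =ᶠ[nhds x]
      fun y => gridBump i.1 y * (∑ i ∈ J, gridBump i.1 y)⁻¹ := by
    filter_upwards [hball] with y hy
    rw [(hnear y hy).2.1]
  have hsmooth : ∀ k : ℕ, ContDiff ℝ k (fun y => ∑ i ∈ J, gridBump i.1 y) := fun k =>
    ContDiff.sum fun i _ => contDiff_gridBump k i.1
  have hinv : ∀ k : ℕ, ContDiffAt ℝ k (fun y => (∑ i ∈ J, gridBump i.1 y)⁻¹) x := fun k =>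
    (hsmooth k).contDiffAt.inv (by linarith [hxb.2.2])
  refine ⟨?_, ?_, fun k hk => ?_⟩
  · exact ((contDiff_gridBump M i.1).contDiffAt.mul (hinv M)).congr_of_eventuallyEq hev
  · have h1 : ‖gridPoint i.1 - x‖ ≤ (2 : ℝ) ^ i.1.1 + D / 4 := (hJ i).1 hi
    have h2 := i.2.2
    rw [hnd, dist_eq_norm] at h2
    have h3 := norm_add_le (x - gridPoint i.1) (gridPoint i.1 - nearest (gridPoint i.1))
    rw [sub_add_sub_cancel, norm_sub_rev x (gridPoint i.1)] at h3
    rw [← hDdef] at hb1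
    have h4 : 0 ≤ K * D := by positivity
    change ‖x - nearest (gridPoint i.1)‖ ≤ (4 + K) * D
    linarith
  · rw [(hev.iteratedFDeriv ℝ k).eq_of_nhds]
    have ht : ∀ j ∈ J, ((2 : ℝ) ^ j.1.1)⁻¹ ≤ 46 * D⁻¹ := by
      intro j hj
      have := (nearIndices_bounds ((hJ j).1 hj)).2
      rw [← div_eq_mul_inv, inv_le_comm₀ (by positivity) (by positivity), inv_div,
        div_le_iff₀ (by norm_num)]
      linarith
    set t := 46 * D⁻¹ with htdef
    have ht0 : 0 ≤ t := by positivity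
    have hbump : ∀ j ∈ J, ∀ l ≤ M, ‖iteratedFDeriv ℝ l (gridBump j.1) x‖ ≤ B * t ^ l := by
      intro j hj l hl
      refine (norm_iteratedFDeriv_comp_smul_sub_le (contDiff_unitBump n l)
        (t := ((2 : ℝ) ^ j.1.1)⁻¹) (by positivity) (hB l hl) _ x).trans ?_
      gcongr
      exact ht j hj
    have hsum : ∀ l ≤ M, ‖iteratedFDeriv ℝ l (fun y => ∑ i ∈ J, gridBump i.1 y) x‖ ≤
        N * B * t ^ l := by
      intro l hl
      rw [iteratedFDeriv_fun_sum_apply fun j _ => (contDiff_gridBump l j.1).contDiffAt]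
      refine (norm_sum_le_of_le _ fun j hj => hbump j hj l hl).trans ?_
      rw [Finset.sum_const, nsmul_eq_mul, ← mul_assoc]
      gcongr
      exact_mod_cast hJc.trans (Nat.le_succ _)
    have hI : ∀ l ≤ k, ‖iteratedFDeriv ℝ l (fun y => (∑ i ∈ J, gridBump i.1 y)⁻¹) x‖ ≤
        (M.factorial * M.factorial * (N * B) ^ M) * t ^ l := by
      intro l hl
      have hlM := hl.trans hk
      refine (norm_iteratedFDeriv_fun_inv_le (D := N * B * t) (hsmooth l).contDiffAt hxb.2.2
        fun j hj1 hj => (hsum j (hj.trans hlM)).trans ?_).trans ?_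
      · rw [mul_pow _ t]
        exact mul_le_mul_of_nonneg_right (le_self_pow₀ hNB (by omega)) (by positivity)
      · calc (l.factorial * l.factorial * (N * B * t) ^ l : ℝ)
            = l.factorial * l.factorial * (N * B) ^ l * t ^ l := by rw [mul_pow _ t]; ring
          _ ≤ M.factorial * M.factorial * (N * B) ^ M * t ^ l := by gcongr
    refine (norm_iteratedFDeriv_mul_le_pow (contDiff_gridBump k i.1).contDiffAt (hinv k)
      (fun l hl => hbump i hi l (hl.trans hk)) hI).trans ?_
    set G : ℝ := M.factorial * M.factorial * (N * B) ^ M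
    have hpow : t ^ k = 46 ^ k * D⁻¹ ^ k := by rw [htdef, mul_pow]
    rw [hpow, ← mul_assoc]
    refine mul_le_mul_of_nonneg_right ?_ (by positivity)
    refine le_trans ?_ (by linarith : K ≤ 4 + K)
    rw [hK]
    have h2 : (2 : ℝ) ^ k ≤ 2 ^ M := pow_le_pow_right₀ (by norm_num) hk
    have h46 : (46 : ℝ) ^ k ≤ 46 ^ M := pow_le_pow_right₀ (by norm_num) hk
    gcongr

/-! ### Comparison of distances -/

theorem IsGrowthDist.self {n : ℕ} {ρ : RN n → RN n → ℝ} (hρ : IsGrowthDist ρ) (a : RN n) :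
    ρ a a = 0 :=
  tendsto_nhds_unique (tendsto_pure_nhds (fun x => ρ x a) a)
    ((hρ.tendsto a).mono_left (pure_le_nhds a))

theorem IsGrowthDist.le_mul {n : ℕ} {ρ : RN n → RN n → ℝ} (hρ : IsGrowthDist ρ) {x y z : RN n}
    {K : ℝ} (h : ‖y - z‖ ≤ K * ‖x - y‖) : ρ y z ≤ (K + 2) * ρ x y := by
  have hg := hρ.growth x y y z ‖x - y‖ le_rfl (by simp)
  rcases eq_or_lt_of_le (norm_nonneg (x - y)) with h0 | h0
  · rw [← h0, mul_zero] at h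
    have hx : x = y := sub_eq_zero.1 (norm_eq_zero.1 h0.symm)
    have hy : y = z := sub_eq_zero.1 (norm_le_zero_iff.1 h)
    subst hx
    subst hy
    rw [hρ.self, mul_zero]
  · refine le_of_mul_le_mul_left ?_ h0
    calc ‖x - y‖ * ρ y z ≤ (‖y - z‖ + 2 * ‖x - y‖) * ρ x y := hg
      _ ≤ (K * ‖x - y‖ + 2 * ‖x - y‖) * ρ x y :=
        mul_le_mul_of_nonneg_right (by linarith) (hρ.nonneg x y)
      _ = _ := by ring

theorem IsGrowthDist.triangle {n : ℕ} {ρ : RN n → RN n → ℝ} (hρ : IsGrowthDist ρ)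
    (x y z : RN n) : ρ x z ≤ 4 * (ρ x y + ρ y z) := by
  have h := norm_add_le (x - y) (y - z)
  rw [sub_add_sub_cancel] at h
  have h1 := hρ.nonneg x y
  have h2 := hρ.nonneg y z
  rcases le_total ‖y - z‖ ‖x - y‖ with hc | hc
  · have := hρ.le_mul (x := y) (y := x) (z := z) (K := 2) (by rw [norm_sub_rev y x]; linarith)
    rw [hρ.symm y x] at this
    linarith
  · have := hρ.le_mul (x := y) (y := z) (z := x) (K := 2) (by rw [norm_sub_rev z x]; linarith)
    rw [hρ.symm z x] at this
    linarith

/-! ### Taylor estimates by the mean value inequality -/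

/-- Bounds for the derivatives of order less than `m` at the centre of a ball and for the
derivative of order `m` on the ball give bounds of the same form on the whole ball, by descending
induction on the order. -/
theorem norm_iteratedFDeriv_le_of_bounds {n m : ℕ} {f : RN n → ℝ} (hf : ContDiff ℝ m f)
    {y : RN n} {r A : ℝ} (hr : 0 ≤ r) (hA : 0 ≤ A)
    (hy : ∀ j < m, ‖iteratedFDeriv ℝ j f y‖ ≤ A * r ^ (m - j))
    (htop : ∀ z, ‖z - y‖ ≤ r → ‖iteratedFDeriv ℝ m f z‖ ≤ A) {k : ℕ} (hk : k ≤ m) {z : RN n}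
    (hz : ‖z - y‖ ≤ r) : ‖iteratedFDeriv ℝ k f z‖ ≤ 2 ^ m * A * r ^ (m - k) := by
  have main : ∀ i k : ℕ, k + i = m → ∀ z, ‖z - y‖ ≤ r →
      ‖iteratedFDeriv ℝ k f z‖ ≤ 2 ^ i * A * r ^ i := by
    intro i
    induction i with
    | zero =>
      rintro k rfl z hz
      simpa using htop z hz
    | succ i ih =>
      intro k hki z hz
      have hd : ∀ w ∈ Metric.closedBall y r, DifferentiableAt ℝ (iteratedFDeriv ℝ k f) w :=
        fun w _ => hf.differentiable_iteratedFDeriv (by exact_mod_cast (by omega : k < m)) w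
      have hb : ∀ w ∈ Metric.closedBall y r,
          ‖fderiv ℝ (iteratedFDeriv ℝ k f) w‖ ≤ 2 ^ i * A * r ^ i := by
        intro w hw
        rw [norm_fderiv_iteratedFDeriv]
        exact ih (k + 1) (by omega) w (mem_closedBall_iff_norm.1 hw)
      have h1 := (convex_closedBall y r).norm_image_sub_le_of_norm_fderiv_le hd hb
        (Metric.mem_closedBall_self hr) (mem_closedBall_iff_norm.2 hz)
      have h2 := hy k (by omega)
      rw [show m - k = i + 1 by omega] at h2
      have h3 := norm_sub_norm_le (iteratedFDeriv ℝ k f z) (iteratedFDeriv ℝ k f y)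
      have h4 : 2 ^ i * A * r ^ i * ‖z - y‖ ≤ 2 ^ i * A * r ^ i * r := by gcongr
      have h5 : A * r ^ (i + 1) ≤ 2 ^ i * (A * r ^ (i + 1)) :=
        le_mul_of_one_le_left (by positivity) (one_le_pow₀ (by norm_num))
      calc ‖iteratedFDeriv ℝ k f z‖ ≤ A * r ^ (i + 1) + 2 ^ i * A * r ^ i * r := by linarith
        _ ≤ 2 ^ i * (A * r ^ (i + 1)) + 2 ^ i * A * r ^ i * r := by linarith
        _ = 2 ^ (i + 1) * A * r ^ (i + 1) := by ring
  refine (main (m - k) k (by omega) z hz).trans ?_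
  gcongr
  · norm_num
  · omega

theorem iteratedFDeriv_const_of_succ_eq_zero {n m : ℕ} {f : RN n → ℝ}
    (hf : ContDiff ℝ (m + 1 : ℕ) f) (h : ∀ x, iteratedFDeriv ℝ (m + 1) f x = 0) (x y : RN n) :
    iteratedFDeriv ℝ m f x = iteratedFDeriv ℝ m f y := by
  refine is_const_of_fderiv_eq_zero (𝕜 := ℝ)
    (hf.differentiable_iteratedFDeriv (by exact_mod_cast Nat.lt_succ_self m)) (fun z => ?_) x y
  rw [← norm_le_zero_iff, norm_fderiv_iteratedFDeriv, h, norm_zero]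

/-! ### Extension of jets off a closed set -/

/-- A Whitney field on `E` in analytic form: a polynomial function `p a` of degree at most `m` for
each `a ∈ E` (expressed by the vanishing of the derivative of order `m + 1`), such that the
derivatives of `p a` and `p b` at `a` differ at most by `A ‖a - b‖^{m-k} ρ(a,b)`. -/
structure IsWhitneyJet {n : ℕ} (m : ℕ) (ρ : RN n → RN n → ℝ) (E : Set (RN n))
    (p : RN n → RN n → ℝ) (A : ℝ) : Prop where
  nonneg : 0 ≤ A
  contDiff : ∀ a ∈ E, ContDiff ℝ (m + 1 : ℕ) (p a)
  succ_eq_zero : ∀ a ∈ E, ∀ x, iteratedFDeriv ℝ (m + 1) (p a) x = 0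
  bound : ∀ a ∈ E, ∀ b ∈ E, ∀ k ≤ m,
    ‖iteratedFDeriv ℝ k (p a) a - iteratedFDeriv ℝ k (p b) a‖ ≤ A * ‖a - b‖ ^ (m - k) * ρ a b

/-- The bounds for `p a - p b` at `a` carry over to points at a distance comparable to `‖a - b‖`. -/
theorem IsWhitneyJet.norm_sub_le {n m : ℕ} {ρ : RN n → RN n → ℝ} {E : Set (RN n)}
    {p : RN n → RN n → ℝ} {A : ℝ} (hp : IsWhitneyJet m ρ E p A) (hρ : IsGrowthDist ρ)
    {a b x : RN n} (ha : a ∈ E) (hb : b ∈ E) {r : ℝ} (hx : ‖x - a‖ ≤ r) (hab : ‖a - b‖ ≤ r)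
    {k : ℕ} (hk : k ≤ m) :
    ‖iteratedFDeriv ℝ k (p a) x - iteratedFDeriv ℝ k (p b) x‖ ≤
      2 ^ m * (A * ρ a b) * r ^ (m - k) := by
  have hr : 0 ≤ r := (norm_nonneg _).trans hx
  have hAρ : 0 ≤ A * ρ a b := mul_nonneg hp.nonneg (hρ.nonneg a b)
  have hle : ∀ {j : ℕ}, j ≤ m + 1 → ((j : ℕ) : WithTop ℕ∞) ≤ (m + 1 : ℕ) := fun h => by
    exact_mod_cast h
  have hsub : ∀ j ≤ m + 1, ∀ z, iteratedFDeriv ℝ j (p a - p b) z =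
      iteratedFDeriv ℝ j (p a) z - iteratedFDeriv ℝ j (p b) z := fun j hj z =>
    iteratedFDeriv_sub_apply ((hp.contDiff a ha).of_le (hle hj)).contDiffAt
      ((hp.contDiff b hb).of_le (hle hj)).contDiffAt
  have hf : ContDiff ℝ (m + 1 : ℕ) (p a - p b) := (hp.contDiff a ha).sub (hp.contDiff b hb)
  have hza : ∀ j ≤ m, ‖iteratedFDeriv ℝ j (p a - p b) a‖ ≤ A * ρ a b * r ^ (m - j) := by
    intro j hj
    rw [hsub j (by omega)]
    refine (hp.bound a ha b hb j hj).trans ?_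
    rw [mul_right_comm]
    gcongr
  rw [← hsub k (by omega)]
  refine norm_iteratedFDeriv_le_of_bounds (hf.of_le (hle (by omega))) hr hAρ
    (fun j hj => hza j hj.le) (fun z _ => ?_) hk hx
  rw [iteratedFDeriv_const_of_succ_eq_zero hf (fun w => by
    rw [hsub _ le_rfl, hp.succ_eq_zero a ha, hp.succ_eq_zero b hb, sub_zero]) z a]
  simpa using hza m le_rfl

/-- Gluing the polynomials of a Whitney field by a Whitney partition of unity gives a function
that is smooth off `E` and close to the polynomial of a nearest point of `E`. -/
theorem exists_extension_off (n m : ℕ) : ∃ C : ℝ, 0 ≤ C ∧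
    ∀ (ρ : RN n → RN n → ℝ) (E : Set (RN n)) (p : RN n → RN n → ℝ) (A : ℝ), IsGrowthDist ρ →
      IsClosed E → E.Nonempty → IsWhitneyJet m ρ E p A →
      ∃ F : RN n → ℝ, ∀ x ∉ E, ContDiffAt ℝ (m + 1 : ℕ) F x ∧
        ∀ a ∈ E, ‖x - a‖ = Metric.infDist x E → ∀ k ≤ m + 1,
          ‖iteratedFDeriv ℝ k F x - iteratedFDeriv ℝ k (p a) x‖ ≤
            C * A * ρ x a * (‖x - a‖ ^ m * ‖x - a‖⁻¹ ^ k) := by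
  obtain ⟨N, C, hC, H⟩ := exists_whitney_partition n (m + 1)
  refine ⟨N * (2 ^ (m + 1) * (C * (2 ^ m * (C + 3) * (C + 1) ^ m))), by positivity,
    fun ρ E p A hρ hE hne hp => ?_⟩
  obtain ⟨ι, φ, a, haE, H⟩ := H E hE hne
  refine ⟨fun y => ∑ᶠ i, φ i y * p (a i) y, fun x hx => ?_⟩
  obtain ⟨J, hJN, hev, hJ⟩ := H x hx
  have hle : ∀ {j : ℕ}, j ≤ m + 1 → ((j : ℕ) : WithTop ℕ∞) ≤ (m + 1 : ℕ) := fun h => by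
    exact_mod_cast h
  have hFJ : (fun y => ∑ᶠ i, φ i y * p (a i) y) =ᶠ[nhds x]
      fun y => ∑ i ∈ J, φ i y * p (a i) y := by
    filter_upwards [hev] with y hy
    refine finsum_eq_sum_of_support_subset _ fun i hi => ?_
    by_contra h
    exact hi (by simp only [hy.1 i h, zero_mul])
  have hF : ContDiffAt ℝ (m + 1 : ℕ) (fun y => ∑ᶠ i, φ i y * p (a i) y) x := by
    refine ContDiffAt.congr_of_eventuallyEq ?_ hFJ
    exact ContDiffAt.sum fun i hi => (hJ i hi).1.mul (hp.contDiff _ (haE i)).contDiffAt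
  refine ⟨hF, fun b hb hxb k hk => ?_⟩
  set D := ‖x - b‖ with hD
  have hD0 : 0 < D := by rw [hxb]; exact (hE.notMem_iff_infDist_pos hne).1 hx
  rw [← iteratedFDeriv_sub_apply (hF.of_le (hle hk))
    ((hp.contDiff b hb).of_le (hle hk)).contDiffAt]
  -- Near `x` the functions `φ i` sum to one, so `p b` can be moved under the sum.
  have hG : (fun y => ∑ᶠ i, φ i y * p (a i) y) - p b =ᶠ[nhds x]
      fun y => ∑ i ∈ J, φ i y * (p (a i) - p b) y := by
    filter_upwards [hev, hFJ] with y hy hy2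
    simp only [Pi.sub_apply, hy2, mul_sub, Finset.sum_sub_distrib, ← Finset.sum_mul, hy.2, one_mul]
  have hpd : ∀ i, ∀ j ≤ m + 1, ContDiffAt ℝ j (p (a i) - p b) x := fun i j hj =>
    (((hp.contDiff _ (haE i)).sub (hp.contDiff b hb)).of_le (hle hj)).contDiffAt
  have hφd : ∀ i ∈ J, ∀ j ≤ m + 1, ContDiffAt ℝ j (φ i) x := fun i hi j hj =>
    (hJ i hi).1.of_le (hle hj)
  rw [(hG.iteratedFDeriv ℝ k).eq_of_nhds,
    iteratedFDeriv_fun_sum_apply fun i hi => (hφd i hi k hk).mul (hpd i k hk)]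
  have hterm : ∀ i ∈ J, ‖iteratedFDeriv ℝ k (fun y => φ i y * (p (a i) - p b) y) x‖ ≤
      2 ^ (m + 1) * (C * (2 ^ m * (C + 3) * (C + 1) ^ m)) *
        (A * ρ x b * (D ^ m * D⁻¹ ^ k)) := by
    intro i hi
    obtain ⟨-, hxa, hφ⟩ := hJ i hi
    rw [← hxb] at hxa hφ
    have hab : ‖b - a i‖ ≤ (C + 1) * D := by
      have := norm_sub_le (x - a i) (x - b)
      rw [sub_sub_sub_cancel_left] at this
      linarith
    have hρb : ρ (a i) b ≤ (C + 3) * ρ x b := by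
      have := hρ.le_mul hab
      rw [hρ.symm (a i) b]
      linarith
    have hpoly : ∀ j ≤ k, ‖iteratedFDeriv ℝ j (p (a i) - p b) x‖ ≤
        2 ^ m * (C + 3) * (C + 1) ^ m * (A * ρ x b * D ^ m) * D⁻¹ ^ j := by
      intro j hj
      have hA := hp.nonneg
      have hρ0 := hρ.nonneg x b
      rw [iteratedFDeriv_sub_apply ((hp.contDiff _ (haE i)).of_le (hle (hj.trans hk))).contDiffAt
        ((hp.contDiff b hb).of_le (hle (hj.trans hk))).contDiffAt]
      rcases Nat.lt_or_ge m j with hmj | hjm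
      · obtain rfl : j = m + 1 := by omega
        rw [hp.succ_eq_zero _ (haE i), hp.succ_eq_zero b hb, sub_zero, norm_zero]
        positivity
      · refine (hp.norm_sub_le hρ (haE i) hb (r := (C + 1) * D) (hxa.trans ?_)
          (by rwa [norm_sub_rev]) hjm).trans ?_
        · gcongr; linarith
        have e : D ^ (m - j) = D ^ m * D⁻¹ ^ j := by
          rw [pow_sub₀ _ hD0.ne' hjm, inv_pow]
        calc 2 ^ m * (A * ρ (a i) b) * ((C + 1) * D) ^ (m - j)
            ≤ 2 ^ m * (A * ((C + 3) * ρ x b)) * ((C + 1) ^ m * D ^ (m - j)) := by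
              rw [mul_pow]
              gcongr
              · linarith
              · omega
          _ = _ := by rw [e]; ring
    have hφ' : ∀ j ≤ k, ‖iteratedFDeriv ℝ j (φ i) x‖ ≤ C * D⁻¹ ^ j := fun j hj =>
      hφ j (hj.trans hk)
    refine (norm_iteratedFDeriv_mul_le_pow (hφd i hi k hk) (hpd i k hk) hφ' hpoly).trans ?_
    have h2 : (2 : ℝ) ^ k ≤ 2 ^ (m + 1) := pow_le_pow_right₀ (by norm_num) hk
    have hA := hp.nonneg
    have hρ0 := hρ.nonneg x b
    calc (2 : ℝ) ^ k * (C * (2 ^ m * (C + 3) * (C + 1) ^ m * (A * ρ x b * D ^ m))) * D⁻¹ ^ k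
        ≤ 2 ^ (m + 1) * (C * (2 ^ m * (C + 3) * (C + 1) ^ m * (A * ρ x b * D ^ m))) *
            D⁻¹ ^ k := by gcongr
      _ = _ := by ring
  refine (norm_sum_le_of_le _ hterm).trans ?_
  rw [Finset.sum_const, nsmul_eq_mul]
  have hA := hp.nonneg
  have hρ0 := hρ.nonneg x b
  calc (J.card : ℝ) * (2 ^ (m + 1) * (C * (2 ^ m * (C + 3) * (C + 1) ^ m)) *
        (A * ρ x b * (D ^ m * D⁻¹ ^ k)))
      ≤ N * (2 ^ (m + 1) * (C * (2 ^ m * (C + 3) * (C + 1) ^ m)) *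
        (A * ρ x b * (D ^ m * D⁻¹ ^ k))) := by gcongr
    _ = _ := by ring

open Classical in
/-- The jet of `p x` at `x` for `x ∈ E`, and the jet of `F` at `x` off `E`. -/
noncomputable def gluedJet {n : ℕ} (E : Set (RN n)) (p : RN n → RN n → ℝ) (F : RN n → ℝ)
    (x : RN n) : FormalMultilinearSeries ℝ (RN n) ℝ :=
  if x ∈ E then ftaylorSeries ℝ (p x) x else ftaylorSeries ℝ F x

theorem gluedJet_of_mem {n : ℕ} {E : Set (RN n)} (p : RN n → RN n → ℝ) (F : RN n → ℝ) {x : RN n}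
    (hx : x ∈ E) (k : ℕ) : gluedJet E p F x k = iteratedFDeriv ℝ k (p x) x := by
  rw [gluedJet, if_pos hx]; rfl

theorem gluedJet_of_notMem {n : ℕ} {E : Set (RN n)} (p : RN n → RN n → ℝ) (F : RN n → ℝ)
    {x : RN n} (hx : x ∉ E) (k : ℕ) : gluedJet E p F x k = iteratedFDeriv ℝ k F x := by
  rw [gluedJet, if_neg hx]; rfl

/-- At every point `x` the glued jet is close to the jet of the polynomial of any `a ∈ E`. -/
theorem norm_gluedJet_sub_le {n m : ℕ} {ρ : RN n → RN n → ℝ} {E : Set (RN n)}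
    {p : RN n → RN n → ℝ} {A C : ℝ} {F : RN n → ℝ} (hρ : IsGrowthDist ρ) (hE : IsClosed E)
    (hp : IsWhitneyJet m ρ E p A) (hC : 0 ≤ C)
    (hF : ∀ x ∉ E, ∀ a ∈ E, ‖x - a‖ = Metric.infDist x E → ∀ k ≤ m + 1,
          ‖iteratedFDeriv ℝ k F x - iteratedFDeriv ℝ k (p a) x‖ ≤
            C * A * ρ x a * (‖x - a‖ ^ m * ‖x - a‖⁻¹ ^ k))
    (x : RN n) {a : RN n} (ha : a ∈ E) {k : ℕ} (hk : k ≤ m) :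
    ‖gluedJet E p F x k - iteratedFDeriv ℝ k (p a) x‖ ≤
      (1 + 3 * C + 4 * 4 ^ m) * A * ‖x - a‖ ^ (m - k) * ρ x a := by
  have hA := hp.nonneg
  have hρ0 := hρ.nonneg x a
  by_cases hx : x ∈ E
  · rw [gluedJet_of_mem _ _ hx]
    refine (hp.bound x hx a ha k hk).trans ?_
    gcongr
    refine le_mul_of_one_le_left hA ?_
    have : (0 : ℝ) ≤ 4 * 4 ^ m := by positivity
    linarith
  · rw [gluedJet_of_notMem _ _ hx]
    obtain ⟨b, hb, hxb⟩ := hE.exists_infDist_eq_dist ⟨a, ha⟩ x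
    rw [dist_eq_norm] at hxb
    have hD0 : 0 < ‖x - b‖ := by
      rw [← hxb]; exact (hE.notMem_iff_infDist_pos ⟨a, ha⟩).1 hx
    have hba : ‖x - b‖ ≤ ‖x - a‖ := by
      rw [← hxb, ← dist_eq_norm]; exact Metric.infDist_le_dist_of_mem ha
    have hab : ‖a - b‖ ≤ 2 * ‖x - a‖ := by
      have := norm_sub_le (x - b) (x - a)
      rw [sub_sub_sub_cancel_left] at this
      linarith
    have hρb : ρ x b ≤ (1 + 2) * ρ x a := by
      have := hρ.le_mul (x := a) (y := x) (z := b) (K := 1) (by rw [norm_sub_rev a x]; linarith)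
      rwa [hρ.symm a x] at this
    have hρab : ρ b a ≤ (2 + 2) * ρ x a := by
      rw [hρ.symm b a]; exact hρ.le_mul hab
    have h1 := hF x hx b hb hxb.symm k (by omega)
    rw [inv_pow, ← pow_sub₀ _ hD0.ne' hk] at h1
    have h2 := hp.norm_sub_le hρ hb ha (x := x) (r := 2 * ‖x - a‖) (k := k)
      (by linarith [norm_nonneg (x - a)]) (by rwa [norm_sub_rev]) hk
    have h3 : C * A * ρ x b * ‖x - b‖ ^ (m - k) ≤
        C * A * ((1 + 2) * ρ x a) * ‖x - a‖ ^ (m - k) := by gcongr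
    have h4 : 2 ^ m * (A * ρ b a) * (2 * ‖x - a‖) ^ (m - k) ≤
        2 ^ m * (A * ((2 + 2) * ρ x a)) * (2 ^ m * ‖x - a‖ ^ (m - k)) := by
      rw [mul_pow]
      gcongr
      · norm_num
      · omega
    have h5 := norm_sub_le_norm_sub_add_norm_sub (iteratedFDeriv ℝ k F x)
      (iteratedFDeriv ℝ k (p b) x) (iteratedFDeriv ℝ k (p a) x)
    have h6 : 0 ≤ A * ‖x - a‖ ^ (m - k) * ρ x a := by positivity
    have h7 : (2 : ℝ) ^ m * 2 ^ m = 4 ^ m := by rw [← mul_pow]; norm_num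
    have h8 : 2 ^ m * (A * ((2 + 2) * ρ x a)) * (2 ^ m * ‖x - a‖ ^ (m - k)) =
        4 * 4 ^ m * (A * ‖x - a‖ ^ (m - k) * ρ x a) := by rw [← h7]; ring
    nlinarith

theorem tendsto_pow_mul_dist {n : ℕ} {ρ : RN n → RN n → ℝ} (hρ : IsGrowthDist ρ) (K : ℝ) (e : ℕ)
    (a : RN n) :
    Filter.Tendsto (fun x => K * ‖x - a‖ ^ e * ρ x a) (nhds a) (nhds 0) := by
  have h : Continuous fun x : RN n => K * ‖x - a‖ ^ e := by fun_prop
  simpa using (h.tendsto a).mul (hρ.tendsto a)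

open Classical in
/-- The glued jet is the Taylor series of a function of class `C^m`. Near a point `a ∈ E` it
differs from the jet of the polynomial `p a` by `o(‖x - a‖^{m-k})` in order `k`, since
`ρ(x,a) → 0`. -/
theorem hasFTaylorSeriesUpTo_gluedJet {n m : ℕ} {ρ : RN n → RN n → ℝ} {E : Set (RN n)}
    {p : RN n → RN n → ℝ} {K : ℝ} {F : RN n → ℝ} (hρ : IsGrowthDist ρ) (hE : IsClosed E)
    (hpc : ∀ a ∈ E, ContDiff ℝ (m + 1 : ℕ) (p a))
    (hFc : ∀ x ∉ E, ContDiffAt ℝ (m + 1 : ℕ) F x)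
    (H : ∀ x, ∀ a ∈ E, ∀ k ≤ m, ‖gluedJet E p F x k - iteratedFDeriv ℝ k (p a) x‖ ≤
      K * ‖x - a‖ ^ (m - k) * ρ x a) :
    HasFTaylorSeriesUpTo m (fun x => if x ∈ E then p x x else F x) (gluedJet E p F) := by
  have hoff : ∀ x ∉ E, ∀ k, (fun y => gluedJet E p F y k) =ᶠ[nhds x] iteratedFDeriv ℝ k F := by
    intro x hx k
    filter_upwards [hE.isOpen_compl.mem_nhds hx] with y hy
    exact gluedJet_of_notMem p F hy k
  have hoffd : ∀ x ∉ E, ∀ k ≤ m, DifferentiableAt ℝ (iteratedFDeriv ℝ k F) x := by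
    intro x hx k hk
    have : ContDiffAt ℝ 1 (iteratedFDeriv ℝ k F) x := (hFc x hx).iteratedFDeriv_right (by
      exact_mod_cast (by omega : 1 + k ≤ m + 1))
    exact this.differentiableAt (by norm_num)
  have hond : ∀ a ∈ E, ∀ k ≤ m, ∀ x, DifferentiableAt ℝ (iteratedFDeriv ℝ k (p a)) x := by
    intro a ha k hk x
    exact (hpc a ha).differentiable_iteratedFDeriv (by exact_mod_cast (by omega : k < m + 1)) x
  refine ⟨fun x => ?_, fun k hk x => ?_, fun k hk => continuous_iff_continuousAt.2 fun x => ?_⟩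
  · by_cases hx : x ∈ E
    · simp only [if_pos hx, gluedJet_of_mem p F hx]; rfl
    · simp only [if_neg hx, gluedJet_of_notMem p F hx]; rfl
  · have hkm : k < m := by exact_mod_cast hk
    by_cases hx : x ∈ E
    · have h1 : HasFDerivAt (iteratedFDeriv ℝ k (p x))
          (iteratedFDeriv ℝ (k + 1) (p x) x).curryLeft x := (hond x hx k hkm.le x).hasFDerivAt
      have h2 : HasFDerivAt (fun y => gluedJet E p F y k - iteratedFDeriv ℝ k (p x) y)
          (0 : RN n →L[ℝ] (RN n) [×k]→L[ℝ] ℝ) x := by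
        rw [hasFDerivAt_iff_isLittleO, Asymptotics.isLittleO_iff]
        intro c hc
        filter_upwards [(tendsto_pow_mul_dist hρ K (m - k - 1) x).eventually
          (gt_mem_nhds hc)] with y hy
        rw [gluedJet_of_mem p F hx, sub_self, sub_zero]
        simp only [zero_apply, sub_zero]
        refine (H y x hx k hkm.le).trans ?_
        have e : ‖y - x‖ ^ (m - k) = ‖y - x‖ ^ (m - k - 1) * ‖y - x‖ := by
          rw [← pow_succ]; congr 1; omega
        rw [e]
        calc K * (‖y - x‖ ^ (m - k - 1) * ‖y - x‖) * ρ y x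
            = (K * ‖y - x‖ ^ (m - k - 1) * ρ y x) * ‖y - x‖ := by ring
          _ ≤ c * ‖y - x‖ := by gcongr
      have h3 := h2.add h1
      rw [zero_add] at h3
      simp only [gluedJet_of_mem p F hx]
      refine h3.congr_of_eventuallyEq (Filter.Eventually.of_forall fun y => ?_)
      simp
    · have h1 : HasFDerivAt (iteratedFDeriv ℝ k F)
          (iteratedFDeriv ℝ (k + 1) F x).curryLeft x := (hoffd x hx k hkm.le).hasFDerivAt
      rw [gluedJet_of_notMem p F hx]
      exact h1.congr_of_eventuallyEq (hoff x hx k)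
  · have hkm : k ≤ m := by exact_mod_cast hk
    by_cases hx : x ∈ E
    · have h1 : Filter.Tendsto (fun y => gluedJet E p F y k - iteratedFDeriv ℝ k (p x) y)
          (nhds x) (nhds 0) :=
        squeeze_zero_norm (fun y => H y x hx k hkm) (tendsto_pow_mul_dist hρ K (m - k) x)
      have h2 := h1.add (hond x hx k hkm x).continuousAt
      rw [zero_add] at h2
      rw [ContinuousAt, gluedJet_of_mem p F hx]
      simpa using h2
    · exact (hoffd x hx k hkm).continuousAt.congr (hoff x hx k).symm

/-- The derivatives of order `m` of the glued jet are Lipschitz with respect to `ρ`. For points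
close to each other relative to their distance to `E` this follows from the bound for the
derivative of order `m + 1`, otherwise from a comparison with the polynomials of nearest points
of `E`. -/
theorem norm_gluedJet_sub_gluedJet_le {n m : ℕ} {ρ : RN n → RN n → ℝ} {E : Set (RN n)}
    {p : RN n → RN n → ℝ} {A C C' : ℝ} {F : RN n → ℝ} (hρ : IsGrowthDist ρ) (hE : IsClosed E)
    (hne : E.Nonempty) (hp : IsWhitneyJet m ρ E p A) (hC : 0 ≤ C) (hC' : 0 ≤ C')
    (hFc : ∀ x ∉ E, ContDiffAt ℝ (m + 1 : ℕ) F x)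
    (hF : ∀ x ∉ E, ∀ a ∈ E, ‖x - a‖ = Metric.infDist x E → ∀ k ≤ m + 1,
          ‖iteratedFDeriv ℝ k F x - iteratedFDeriv ℝ k (p a) x‖ ≤
            C * A * ρ x a * (‖x - a‖ ^ m * ‖x - a‖⁻¹ ^ k))
    (H : ∀ x, ∀ a ∈ E, ∀ k ≤ m, ‖gluedJet E p F x k - iteratedFDeriv ℝ k (p a) x‖ ≤
      C' * A * ‖x - a‖ ^ (m - k) * ρ x a) (x y : RN n) :
    ‖gluedJet E p F x m - gluedJet E p F y m‖ ≤ (3 * C + 8 * C' + 96) * A * ρ x y := by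
  have hA := hp.nonneg
  have close : ∀ x y : RN n, 2 * ‖x - y‖ < Metric.infDist x E →
      ‖gluedJet E p F x m - gluedJet E p F y m‖ ≤ (3 * C + 8 * C' + 96) * A * ρ x y := by
    intro x y hxy
    have hρ0 := hρ.nonneg x y
    rcases eq_or_ne x y with rfl | hne'
    · rw [sub_self, norm_zero]; positivity
    have hs : 0 < ‖x - y‖ := norm_pos_iff.2 (sub_ne_zero.2 hne')
    have hz : ∀ z ∈ segment ℝ x y, z ∉ E ∧ ‖x - z‖ ≤ ‖x - y‖ ∧ ‖y - z‖ ≤ ‖x - y‖ ∧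
        ‖x - y‖ ≤ Metric.infDist z E := by
      intro z hz
      have hadd := dist_add_dist_of_mem_segment hz
      rw [dist_eq_norm, dist_eq_norm, dist_eq_norm, norm_sub_rev z y] at hadd
      have h1 : ‖x - z‖ ≤ ‖x - y‖ := by linarith [norm_nonneg (y - z)]
      have h2 : ‖y - z‖ ≤ ‖x - y‖ := by linarith [norm_nonneg (x - z)]
      have h3 := infDist_sub_le E x z
      have h4 : ‖x - y‖ ≤ Metric.infDist z E := by linarith
      exact ⟨(hE.notMem_iff_infDist_pos hne).2 (by linarith), h1, h2, h4⟩
    have hd : ∀ z ∈ segment ℝ x y, DifferentiableAt ℝ (iteratedFDeriv ℝ m F) z := by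
      intro z hzs
      have : ContDiffAt ℝ 1 (iteratedFDeriv ℝ m F) z :=
        (hFc z (hz z hzs).1).iteratedFDeriv_right (by exact_mod_cast (add_comm 1 m).le)
      exact this.differentiableAt (by norm_num)
    have hb : ∀ z ∈ segment ℝ x y,
        ‖fderiv ℝ (iteratedFDeriv ℝ m F) z‖ ≤ 3 * C * A * ρ x y / ‖x - y‖ := by
      intro z hzs
      obtain ⟨hzE, h1, h2, h3⟩ := hz z hzs
      obtain ⟨b, hb, hzb⟩ := hE.exists_infDist_eq_dist hne z
      rw [dist_eq_norm] at hzb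
      have h4 := hF z hzE b hb hzb.symm (m + 1) le_rfl
      rw [hp.succ_eq_zero b hb, sub_zero] at h4
      rw [norm_fderiv_iteratedFDeriv]
      have hg := hρ.growth x y z b ‖x - y‖ h1 h2
      rw [hzb] at h3
      have hD0 : 0 < ‖z - b‖ := hs.trans_le h3
      have e : ‖z - b‖ ^ m * ‖z - b‖⁻¹ ^ (m + 1) = ‖z - b‖⁻¹ := by
        rw [pow_succ, ← mul_assoc, ← mul_pow, mul_inv_cancel₀ hD0.ne', one_pow, one_mul]
      rw [e] at h4
      refine h4.trans ?_
      rw [← div_eq_mul_inv, div_le_div_iff₀ hD0 hs]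
      calc C * A * ρ z b * ‖x - y‖ = C * A * (‖x - y‖ * ρ z b) := by ring
        _ ≤ C * A * ((‖z - b‖ + 2 * ‖z - b‖) * ρ x y) := by
          refine mul_le_mul_of_nonneg_left (hg.trans ?_) (by positivity)
          gcongr
        _ = 3 * C * A * ρ x y * ‖z - b‖ := by ring
    have h := (convex_segment x y).norm_image_sub_le_of_norm_fderiv_le hd hb
      (right_mem_segment ℝ x y) (left_mem_segment ℝ x y)
    rw [div_mul_cancel₀ _ hs.ne'] at h
    rw [gluedJet_of_notMem p F (hz x (left_mem_segment ℝ x y)).1,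
      gluedJet_of_notMem p F (hz y (right_mem_segment ℝ x y)).1]
    refine h.trans ?_
    gcongr
    linarith
  rcases lt_or_ge (2 * ‖x - y‖) (Metric.infDist x E) with hx | hx
  · exact close x y hx
  rcases lt_or_ge (2 * ‖x - y‖) (Metric.infDist y E) with hy | hy
  · rw [norm_sub_rev, hρ.symm x y]
    exact close y x (by rwa [norm_sub_rev])
  obtain ⟨a, ha, hxa⟩ := hE.exists_infDist_eq_dist hne x
  obtain ⟨b, hb, hyb⟩ := hE.exists_infDist_eq_dist hne y
  rw [hxa, dist_eq_norm] at hx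
  rw [hyb, dist_eq_norm] at hy
  have hρxa : ρ x a ≤ (2 + 2) * ρ x y := by
    have := hρ.le_mul (x := y) (y := x) (z := a) (K := 2) (by rwa [norm_sub_rev y x])
    rwa [hρ.symm y x] at this
  have hρyb : ρ y b ≤ (2 + 2) * ρ x y := hρ.le_mul hy
  have hρab : ρ a b ≤ 96 * ρ x y := by
    have h1 := hρ.triangle a x b
    have h2 := hρ.triangle x y b
    rw [hρ.symm a x] at h1
    linarith
  have hconst : ∀ c ∈ E, ∀ u v, iteratedFDeriv ℝ m (p c) u = iteratedFDeriv ℝ m (p c) v :=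
    fun c hc => iteratedFDeriv_const_of_succ_eq_zero (hp.contDiff c hc) (hp.succ_eq_zero c hc)
  have h1 := H x a ha m le_rfl
  have h2 := H y b hb m le_rfl
  have h3 := hp.bound a ha b hb m le_rfl
  rw [hconst a ha x a] at h1
  rw [hconst b hb y a, norm_sub_rev] at h2
  rw [Nat.sub_self, pow_zero, mul_one] at h1 h2 h3
  have h4 := norm_sub_le_norm_sub_add_norm_sub (gluedJet E p F x m)
    (iteratedFDeriv ℝ m (p a) a) (gluedJet E p F y m)
  have h5 := norm_sub_le_norm_sub_add_norm_sub (iteratedFDeriv ℝ m (p a) a)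
    (iteratedFDeriv ℝ m (p b) a) (gluedJet E p F y m)
  have h6 : C' * A * ρ x a ≤ C' * A * ((2 + 2) * ρ x y) := by gcongr
  have h7 : C' * A * ρ y b ≤ C' * A * ((2 + 2) * ρ x y) := by gcongr
  have h8 : A * ρ a b ≤ A * (96 * ρ x y) := by gcongr
  have h9 : 0 ≤ C * A * ρ x y := mul_nonneg (mul_nonneg hC hA) (hρ.nonneg x y)
  nlinarith

/-- The Whitney extension theorem for jets controlled by a distance satisfying the growth
condition. -/
theorem exists_whitney_extension (n m : ℕ) : ∃ C : ℝ, 0 ≤ C ∧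
    ∀ (ρ : RN n → RN n → ℝ) (E : Set (RN n)) (p : RN n → RN n → ℝ) (A : ℝ), IsGrowthDist ρ →
      IsClosed E → E.Nonempty → IsWhitneyJet m ρ E p A →
      ∃ F : RN n → ℝ, ContDiff ℝ m F ∧
        (∀ a ∈ E, ∀ k ≤ m, iteratedFDeriv ℝ k F a = iteratedFDeriv ℝ k (p a) a) ∧
        ∀ x y, ‖iteratedFDeriv ℝ m F x - iteratedFDeriv ℝ m F y‖ ≤ C * A * ρ x y := by
  classical
  obtain ⟨C, hC, H⟩ := exists_extension_off n m
  refine ⟨3 * C + 8 * (1 + 3 * C + 4 * 4 ^ m) + 96, by positivity,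
    fun ρ E p A hρ hE hne hp => ?_⟩
  obtain ⟨F, hF⟩ := H ρ E p A hρ hE hne hp
  have hFc := fun x hx => (hF x hx).1
  have hFb := fun x hx => (hF x hx).2
  have hest := fun x a ha k hk =>
    norm_gluedJet_sub_le hρ hE hp hC hFb x (a := a) ha (k := k) hk
  have hT := hasFTaylorSeriesUpTo_gluedJet hρ hE hp.contDiff hFc hest
  have heq : ∀ k ≤ m, ∀ x, gluedJet E p F x k =
      iteratedFDeriv ℝ k (fun x => if x ∈ E then p x x else F x) x := fun k hk x =>
    hT.eq_iteratedFDeriv (by exact_mod_cast hk) x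
  refine ⟨_, hT.contDiff, fun a ha k hk => ?_, fun x y => ?_⟩
  · rw [← heq k hk, gluedJet_of_mem p F ha]
  · rw [← heq m le_rfl, ← heq m le_rfl]
    exact norm_gluedJet_sub_gluedJet_le hρ hE hne hp hC (by positivity) hFc hFb hest x y

/-! ### Restriction and extension in terms of the seminorms -/

theorem ofReal_le_of_div_le {a b : ℝ} {e L : ℝ≥0∞} (he : e ≤ ENNReal.ofReal b) (hb : 0 ≤ b)
    (hL : L ≠ ∞) (h : ENNReal.ofReal a / e ≤ L) : a ≤ L.toReal * b := by
  have het : e ≠ ∞ := (he.trans_lt ENNReal.ofReal_lt_top).ne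
  rw [ENNReal.div_le_iff_le_mul (Or.inr hL) (Or.inl het)] at h
  have h2 : ENNReal.ofReal a ≤ ENNReal.ofReal (L.toReal * b) := by
    rw [ENNReal.ofReal_mul ENNReal.toReal_nonneg, ENNReal.ofReal_toReal hL]
    exact h.trans (by gcongr)
  exact (ENNReal.ofReal_le_ofReal_iff (by positivity)).1 h2

theorem abs_sub_le_of_cmdNorm {n m : ℕ} {d : RN n → RN n → ℝ≥0∞} {ρ : RN n → RN n → ℝ}
    (hρ : IsGrowthDist ρ) (hd : ∀ x y, d x y ≤ ENNReal.ofReal (ρ x y)) {F : RN n → ℝ}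
    (hF : cmdNorm m d F ≠ ∞) {α : Fin n → ℕ} (hα : α ∈ multiIndexEq n m) (x y : RN n) :
    |partialD α F x - partialD α F y| ≤ (cmdNorm m d F).toReal * ρ x y := by
  have h0 := hρ.nonneg x y
  rcases eq_or_ne x y with rfl | hxy
  · rw [sub_self, abs_zero]; positivity
  refine ofReal_le_of_div_le (hd x y) h0 hF ?_
  refine le_trans ?_ (Finset.single_le_sum (f := fun α => lipNorm d (partialD α F))
    (fun _ _ => zero_le) hα)
  exact le_iSup_of_le x <| le_iSup_of_le y <| le_iSup_of_le hxy le_rfl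

theorem cmdNorm_ne_top {n m : ℕ} {d : RN n → RN n → ℝ≥0∞} {F : RN n → ℝ} (hF : F ∈ CMd m d) :
    cmdNorm m d F ≠ ∞ := by
  refine (ENNReal.sum_lt_top.2 fun α hα => ?_).ne
  obtain ⟨K, hK⟩ := hF.2 α hα
  refine lt_of_le_of_lt ?_ (ENNReal.coe_lt_top (r := K))
  exact iSup_le fun x => iSup_le fun y => iSup_le fun _ => ENNReal.div_le_of_le_mul (hK x y)

theorem totalDegree_le_of_whitneyField {n m : ℕ} {E : Set (RN n)} (P : WhitneyField m E) (x : E) :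
    (P x : MvPolynomial (Fin n) ℝ).totalDegree ≤ m :=
  (MvPolynomial.mem_restrictTotalDegree _ _ _).1 (P x).2

theorem iteratedFDeriv_eq_of_agreesWith {n m : ℕ} {E : Set (RN n)} {P : WhitneyField m E}
    {F : RN n → ℝ} (hF : ContDiff ℝ m F) (h : AgreesWith F P) (x : E) {k : ℕ} (hk : k ≤ m) :
    iteratedFDeriv ℝ k F x = iteratedFDeriv ℝ k (polyFun (P x)) x := by
  have := norm_iteratedFDeriv_sub_le (hF.of_le (by exact_mod_cast hk : (k : WithTop ℕ∞) ≤ m))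
    (contDiff_polyFun (P x : MvPolynomial (Fin n) ℝ)) (x : RN n) (x : RN n) le_rfl
    (fun α hα => by
      rw [partialD_eq_of_taylorPoly_eq (h x) ((mem_multiIndexEq.1 hα).trans_le hk), sub_self,
        abs_zero])
  rw [mul_zero, norm_le_zero_iff, sub_eq_zero] at this
  exact this

/-- The restriction to `E` of the jet of a function in `C^{m,(d)}` is controlled by the seminorm
of the function. -/
theorem exists_fieldNorm_le (n m : ℕ) : ∃ C : ℝ≥0, ∀ (d : RN n → RN n → ℝ≥0∞)
    (ρ : RN n → RN n → ℝ), IsGrowthDist ρ →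
    (∀ x y, d x y ≤ ENNReal.ofReal (ρ x y) ∧ ENNReal.ofReal (ρ x y) ≤ 5 * d x y) →
    ∀ (E : Set (RN n)) (P : WhitneyField m E), ∀ F ∈ CMd m d, AgreesWith F P →
      fieldNorm d P ≤ C * cmdNorm m d F := by
  refine ⟨(multiIndexLE n m).card * (Real.toNNReal (2 ^ m * (n ^ m * 3)) * 5),
    fun d ρ hρ hd E P F hF hagree => ?_⟩
  have hL := cmdNorm_ne_top hF
  set L := cmdNorm m d F
  refine iSup_le fun x => iSup_le fun y => iSup_le fun hxy => ?_
  have hle : ∀ {k : ℕ}, k ≤ m → (k : WithTop ℕ∞) ≤ m := fun h => by exact_mod_cast h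
  have hP : ∀ (z : E) {N : WithTop ℕ∞}, ContDiff ℝ N (polyFun (P z : MvPolynomial (Fin n) ℝ)) :=
    fun z N => contDiff_polyFun _
  have hρ0 := hρ.nonneg x y
  have hsub : ∀ k ≤ m, ∀ z, iteratedFDeriv ℝ k (F - polyFun (P y : MvPolynomial (Fin n) ℝ)) z =
      iteratedFDeriv ℝ k F z - iteratedFDeriv ℝ k (polyFun (P y : MvPolynomial (Fin n) ℝ)) z :=
    fun k hk z => iteratedFDeriv_sub_apply (hF.1.of_le (hle hk)).contDiffAt (hP y).contDiffAt
  have key : ∀ k ≤ m, ‖iteratedFDeriv ℝ k (polyFun (P x : MvPolynomial (Fin n) ℝ)) x -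
      iteratedFDeriv ℝ k (polyFun (P y : MvPolynomial (Fin n) ℝ)) x‖ ≤
      2 ^ m * (n ^ m * (L.toReal * (3 * ρ x y))) * ‖(x : RN n) - y‖ ^ (m - k) := by
    intro k hk
    rw [← iteratedFDeriv_eq_of_agreesWith hF.1 hagree x hk, ← hsub k hk]
    refine norm_iteratedFDeriv_le_of_bounds (f := F - polyFun (P y : MvPolynomial (Fin n) ℝ))
      (hF.1.sub (hP y)) (y := (y : RN n)) (norm_nonneg _)
      (by positivity) (fun j hj => ?_) (fun z hz => ?_) hk le_rfl
    · rw [hsub j hj.le, iteratedFDeriv_eq_of_agreesWith hF.1 hagree y hj.le, sub_self, norm_zero]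
      positivity
    · rw [hsub m le_rfl, iteratedFDeriv_const_of_succ_eq_zero (hP y)
        (fun w => iteratedFDeriv_polyFun_eq_zero (totalDegree_le_of_whitneyField P y)
          (Nat.lt_succ_self m) w) z y, ← iteratedFDeriv_eq_of_agreesWith hF.1 hagree y le_rfl]
      refine norm_iteratedFDeriv_sub_le hF.1 hF.1 z y (by positivity) fun α hα => ?_
      refine (abs_sub_le_of_cmdNorm hρ (fun x y => (hd x y).1) hL hα z y).trans ?_
      gcongr
      have := hρ.le_mul (x := (x : RN n)) (y := y) (z := z) (K := 1)
        (by rw [norm_sub_rev, one_mul]; exact hz)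
      rw [hρ.symm z y]
      linarith
  refine (Finset.sum_le_card_nsmul _ _
    ((Real.toNNReal (2 ^ m * (n ^ m * 3)) * 5 : ℝ≥0) * L) fun α hα => ?_).trans (le_of_eq ?_)
  · have hα' := mem_multiIndexLE.1 hα
    refine ENNReal.div_le_of_le_mul ?_
    calc ENNReal.ofReal |partialD α (polyFun (P x : MvPolynomial (Fin n) ℝ)) x -
          partialD α (polyFun (P y : MvPolynomial (Fin n) ℝ)) x|
        ≤ ENNReal.ofReal ((2 ^ m * (n ^ m * 3)) * L.toReal *
            ‖(x : RN n) - y‖ ^ (m - ∑ i, α i) * ρ x y) := by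
          refine ENNReal.ofReal_le_ofReal (((abs_partialD_sub_le α _ _ _ _).trans
            (key _ hα')).trans (le_of_eq (by ring)))
      _ = ENNReal.ofReal (2 ^ m * (n ^ m * 3)) * L *
            ENNReal.ofReal (‖(x : RN n) - y‖ ^ (m - ∑ i, α i)) * ENNReal.ofReal (ρ x y) := by
          rw [ENNReal.ofReal_mul (by positivity), ENNReal.ofReal_mul (by positivity),
            ENNReal.ofReal_mul (by positivity), ENNReal.ofReal_toReal hL]
      _ ≤ ENNReal.ofReal (2 ^ m * (n ^ m * 3)) * L *
            ENNReal.ofReal (‖(x : RN n) - y‖ ^ (m - ∑ i, α i)) * (5 * d x y) := by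
          gcongr
          exact (hd x y).2
      _ = _ := by
          push_cast
          rw [ENNReal.ofReal]
          ring
  · rw [nsmul_eq_mul]
    push_cast
    ring

/-- A Whitney field of finite norm extends to a function in `C^{m,(d)}` with seminorm bounded by
a multiple of the norm of the field. -/
theorem exists_extension_cmdNorm_le (n m : ℕ) : ∃ C : ℝ≥0, ∀ (d : RN n → RN n → ℝ≥0∞)
    (ρ : RN n → RN n → ℝ), IsGrowthDist ρ →
    (∀ x y, d x y ≤ ENNReal.ofReal (ρ x y) ∧ ENNReal.ofReal (ρ x y) ≤ 5 * d x y) →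
    ∀ (E : Set (RN n)), IsClosed E → ∀ P : WhitneyField m E, fieldNorm d P ≠ ∞ →
      ∃ F ∈ CMd m d, AgreesWith F P ∧ cmdNorm m d F ≤ C * fieldNorm d P := by
  classical
  obtain ⟨C, hC, H⟩ := exists_whitney_extension n m
  refine ⟨(multiIndexEq n m).card * (Real.toNNReal (C * (n + 1) ^ m) * 5),
    fun d ρ hρ hd E hE P hP => ?_⟩
  set Λ := fieldNorm d P with hΛ
  rcases E.eq_empty_or_nonempty with rfl | hne
  · have h0 : ∀ (α : Fin n → ℕ) (x : RN n), partialD α (0 : RN n → ℝ) x = 0 := by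
      intro α x
      have : iteratedFDeriv ℝ (∑ i, α i) (0 : RN n → ℝ) x = 0 := by
        have e : (0 : RN n → ℝ) = fun _ => 0 := rfl
        rw [e, iteratedFDeriv_fun_zero]; rfl
      rw [partialD, this]; rfl
    refine ⟨0, ⟨contDiff_const, fun α _ => ⟨0, fun x y => by simp [h0]⟩⟩, fun x => x.2.elim, ?_⟩
    simp [cmdNorm, lipNorm, h0]
  let p : RN n → RN n → ℝ := fun a =>
    if h : a ∈ E then polyFun (P ⟨a, h⟩ : MvPolynomial (Fin n) ℝ) else 0
  have hpE : ∀ a (h : a ∈ E), p a = polyFun (P ⟨a, h⟩ : MvPolynomial (Fin n) ℝ) := fun a h => by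
    simp only [p, dif_pos h]
  have hjet : IsWhitneyJet m ρ E p ((n + 1) ^ m * Λ.toReal) := by
    refine ⟨by positivity, fun a ha => ?_, fun a ha x => ?_, fun a ha b hb k hk => ?_⟩
    · rw [hpE a ha]; exact contDiff_polyFun _
    · rw [hpE a ha]
      exact iteratedFDeriv_polyFun_eq_zero (totalDegree_le_of_whitneyField P _)
        (Nat.lt_succ_self m) x
    · have hρ0 := hρ.nonneg a b
      rw [hpE a ha, hpE b hb]
      refine (norm_iteratedFDeriv_sub_le (contDiff_polyFun _) (contDiff_polyFun _) a a
        (B := Λ.toReal * (‖a - b‖ ^ (m - k) * ρ a b)) (by positivity) fun α hα => ?_).trans ?_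
      · have hαk := mem_multiIndexEq.1 hα
        rcases eq_or_ne a b with rfl | hab
        · rw [sub_self, abs_zero]; positivity
        have hαm : α ∈ multiIndexLE n m := mem_multiIndexLE.2 (hαk.trans_le hk)
        refine ofReal_le_of_div_le
          (e := ENNReal.ofReal (‖a - b‖ ^ (m - k)) * d a b) ?_ (by positivity) hP ?_
        · rw [ENNReal.ofReal_mul (by positivity)]
          gcongr
          exact (hd a b).1
        · rw [← hαk]
          refine le_trans ?_ (le_iSup_of_le ⟨a, ha⟩ <| le_iSup_of_le ⟨b, hb⟩ <|
            le_iSup_of_le (by simpa using hab) le_rfl)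
          exact Finset.single_le_sum (f := fun α : Fin n → ℕ => ENNReal.ofReal
            |partialD α (polyFun (P ⟨a, ha⟩ : MvPolynomial (Fin n) ℝ)) a -
              partialD α (polyFun (P ⟨b, hb⟩ : MvPolynomial (Fin n) ℝ)) a| /
            (ENNReal.ofReal (‖a - b‖ ^ (m - ∑ i, α i)) * d a b)) (fun _ _ => zero_le) hαm
      · have h1 : (n : ℝ) ^ k ≤ (n + 1) ^ m :=
          (pow_le_pow_left₀ (by positivity) (by linarith) k).trans
            (pow_le_pow_right₀ (by linarith [Nat.cast_nonneg (α := ℝ) n]) hk)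
        calc (n : ℝ) ^ k * (Λ.toReal * (‖a - b‖ ^ (m - k) * ρ a b))
            ≤ (n + 1) ^ m * (Λ.toReal * (‖a - b‖ ^ (m - k) * ρ a b)) := by gcongr
          _ = _ := by ring
  obtain ⟨F, hFc, hFE, hFlip⟩ := H ρ E p _ hρ hE hne hjet
  have hlip : ∀ α ∈ multiIndexEq n m, ∀ x y, ENNReal.ofReal |partialD α F x - partialD α F y| ≤
      (Real.toNNReal (C * (n + 1) ^ m) * 5 : ℝ≥0) * Λ * d x y := by
    intro α hα x y
    have h1 := abs_partialD_sub_le α F F x y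
    rw [mem_multiIndexEq.1 hα] at h1
    calc ENNReal.ofReal |partialD α F x - partialD α F y|
        ≤ ENNReal.ofReal (C * (n + 1) ^ m * Λ.toReal * ρ x y) :=
          ENNReal.ofReal_le_ofReal ((h1.trans (hFlip x y)).trans (le_of_eq (by ring)))
      _ = ENNReal.ofReal (C * (n + 1) ^ m) * Λ * ENNReal.ofReal (ρ x y) := by
          rw [ENNReal.ofReal_mul (by positivity), ENNReal.ofReal_mul (by positivity),
            ENNReal.ofReal_toReal hP]
      _ ≤ ENNReal.ofReal (C * (n + 1) ^ m) * Λ * (5 * d x y) := by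
          gcongr
          exact (hd x y).2
      _ = _ := by
          push_cast
          rw [ENNReal.ofReal]
          ring
  refine ⟨F, ⟨hFc, fun α hα => ⟨Real.toNNReal (C * (n + 1) ^ m) * 5 * Λ.toNNReal, fun x y => ?_⟩⟩,
    fun x => ?_, ?_⟩
  · rw [ENNReal.coe_mul, ENNReal.coe_toNNReal hP]
    exact hlip α hα x y
  · refine taylorPoly_eq_of_partialD_eq (totalDegree_le_of_whitneyField P x) fun α hα => ?_
    rw [partialD, partialD, hFE x x.2 _ hα, hpE x x.2]
  · refine (Finset.sum_le_card_nsmul _ _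
      ((Real.toNNReal (C * (n + 1) ^ m) * 5 : ℝ≥0) * Λ) fun α hα => ?_).trans (le_of_eq ?_)
    · exact iSup_le fun x => iSup_le fun y => iSup_le fun _ =>
        ENNReal.div_le_of_le_mul (hlip α hα x y)
    · rw [nsmul_eq_mul]
      push_cast
      ring

end WhitneyJet

theorem mainTheorem8 (n m : ℕ) (hn : 1 ≤ n) (p q : ℝ) (hnq : (n : ℝ) < q) (hqp : q < p) :
    ∃ C : ℝ≥0, 1 ≤ C ∧
      ∀ d ∈ WhitneyJet.DPQ n p q, ∀ E : Set (WhitneyJet.RN n), IsClosed E →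
        ∀ P : WhitneyJet.WhitneyField m E,
          ((∃ F ∈ WhitneyJet.CMd m d, WhitneyJet.AgreesWith F P) ↔
            WhitneyJet.fieldNorm d P < ∞) ∧
          WhitneyJet.fieldNorm d P ≤ C * WhitneyJet.extNorm d P ∧
          WhitneyJet.extNorm d P ≤ C * WhitneyJet.fieldNorm d P := by
  obtain ⟨C₁, h₁⟩ := WhitneyJet.exists_fieldNorm_le n m
  obtain ⟨C₂, h₂⟩ := WhitneyJet.exists_extension_cmdNorm_le n m
  refine ⟨1 + C₁ + C₂, by rw [add_assoc]; exact le_self_add, fun d hd E hE P => ?_⟩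
  obtain ⟨ρ, hρ, hdρ⟩ := WhitneyJet.exists_isGrowthDist hn hnq hqp hd
  have hC₁ : (C₁ : ℝ≥0∞) ≤ (1 + C₁ + C₂ : ℝ≥0) := by
    exact_mod_cast (by rw [add_comm 1, add_assoc]; exact le_self_add : C₁ ≤ 1 + C₁ + C₂)
  have hC₂ : (C₂ : ℝ≥0∞) ≤ (1 + C₁ + C₂ : ℝ≥0) := by
    exact_mod_cast (le_add_self : C₂ ≤ 1 + C₁ + C₂)
  have hfield := h₁ d ρ hρ hdρ E P
  have hext := h₂ d ρ hρ hdρ E hE P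
  refine ⟨⟨?_, fun h => ?_⟩, ?_, ?_⟩
  · rintro ⟨F, hF, hagree⟩
    exact (hfield F hF hagree).trans_lt
      (ENNReal.mul_lt_top ENNReal.coe_lt_top (WhitneyJet.cmdNorm_ne_top hF).lt_top)
  · obtain ⟨F, hF, hagree, -⟩ := hext h.ne
    exact ⟨F, hF, hagree⟩
  · have hC0 : ((1 + C₁ + C₂ : ℝ≥0) : ℝ≥0∞) ≠ 0 := by
      have : (1 + C₁ + C₂ : ℝ≥0) ≠ 0 := by positivity
      exact_mod_cast this
    rw [mul_comm, ← ENNReal.div_le_iff hC0 ENNReal.coe_ne_top]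
    refine le_iInf fun F => le_iInf fun hF => le_iInf fun hagree => ?_
    rw [ENNReal.div_le_iff hC0 ENNReal.coe_ne_top, mul_comm]
    exact (hfield F hF hagree).trans (by gcongr)
  · by_cases h : WhitneyJet.fieldNorm d P = ∞
    · rw [h, ENNReal.mul_top (by
        have : (1 + C₁ + C₂ : ℝ≥0) ≠ 0 := by positivity
        exact_mod_cast this)]
      exact le_top
    · obtain ⟨F, hF, hagree, hle⟩ := hext h
      have hinf : WhitneyJet.extNorm d P ≤ WhitneyJet.cmdNorm m d F := by
        unfold WhitneyJet.extNorm
        exact iInf_le_of_le F <| iInf_le_of_le hF <| iInf_le_of_le hagree le_rfl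
      exact (hinf.trans hle).trans (by gcongr)
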